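/- Let $R$ be a commutative unital ring. A bicomplex $A$ consists of $R$-modules $A^{i,j}$ ($i,j\in\mathbb Z$) with differentials $d_0\colon A^{i,j}\to A^{i,j+1}$ and $d_1\colon A^{i,j}\to A^{i-1,j}$ satisfying $d_0d_0=0$, $d_1d_1=0$, $d_0d_1=d_1d_0$; let $b\mathcal C$ be the category of bicomplexes. The witness cycles of $A$ are $ZW_0^{p,q}(A)=A^{p,q}$ and, for $r\ge 1$, $$ZW_r^{p,q}(A)=\Big\{(a_0,\dots,a_{r-1})\in\bigoplus_{k=0}^{r-1}A^{p-k,q-k}\ \Big|\ d_0a_0=0,\ d_0a_k=d_1a_{k-1}\text{ for }k\ge1\Big\}.$$ The witness boundaries are $BW_0^{p,q}(A)=0$, $BW_1^{p,q}(A)=A^{p,q}$ and, for $r\ge2$, $BW_r^{p,q}(A)=ZW_{r-1}^{p+r-1,q+r-1}(A)\oplus A^{p,q}\oplus ZW_{r-1}^{p-1,q}(A)$. The map $w_r\colon BW_r^{p,q-1}(A)\to ZW_r^{p,q}(A)$ is $0$ for $r=0$, is $d_0$ for $r=1$, and for $r\geq 2$ sends $(b,a,c)$ to $(d_1b_{r-2}+d_0a,\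 d_1a+c_0,\ c_1,\dots,c_{r-2})$. The $r$-page of the spectral sequence associated with $A$ is $E_r^{p,q}(A)=ZW_r^{p,q}(A)/w_r(BW_r^{p,q-1}(A))$, and a morphism of bicomplexes is an $r$-quasi-isomorphism if it induces isomorphisms $E_{r+1}^{p,q}(A)\cong E_{r+1}^{p,q}(B)$ for all $p,q$. Let $\mathcal{ZW}_0(p,q)$ be the bicomplex which is free on generators $x,d_0x,d_1x,d_0d_1x$ with $x$ in bidegree $(p,q)$. For $r\ge1$ let $\mathcal{ZW}_r(p,q)$ be the bicomplex which is free on generators $a_k$ in bidegree $(p-k,q-k)$ and $b_k$ in bidegree $(p-k-1,q-k)$, $0\le k\le r-1$, with $d_1a_k=b_k$, $d_0a_0=0$, $d_0a_k=b_{k-1}$ for $k\ge1$, and with zero differentials on the $b_k$. Let $\mathcal{BW}_0(p,q)=0$, $\mathcal{BW}_1(p,q)=\mathcal{ZW}_0(p,q)$, and for $r\ge2$ let $\mathcal{BW}_r(p,q)=\mathcal{ZW}_{r-1}(p+r-1,q+r-1)\oplus\mathcal{ZW}_0(p,q)\oplus\mathcal{ZW}_{r-1}(p-1,q)$. These bicomplexes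 represent $ZW_r^{p,q}$ and $BW_r^{p,q}$. Let $\phi_r\colon\mathcal{ZW}_r(p,q)\to\mathcal{BW}_r(p,q-1)$ be the morphism that induces $w_r$. Put $$I_r=\{\phi_{r+1}\colon\mathcal{ZW}_{r+1}(p,q)\to\mathcal{BW}_{r+1}(p,q-1)\}_{p,q\in\mathbb Z},\qquad J_s=\{0\to\mathcal{ZW}_s(p,q)\}_{p,q\in\mathbb Z}\cup\{0\to\mathcal{ZW}_0(p,q)\}_{p,q\in\mathbb Z},$$ and $J_S=\bigcup_{s\in S}J_s$, $I_S=I_r\cup\bigcup_{s\in S}J_s$. **Theorem.** For every $r\ge0$ and every subset $S\subseteq\{0,1,\dots,r\}$ containing both $0$ and $r$, the category $b\mathcal C$ admits a right proper, finitely cofibrantly generated model structure $(b\mathcal C)_S$ (where a model category is complete and cocomplete and has functorial factorizations) in which 1. the weak equivalences are the $r$-quasi-isomorphisms, 2. the fibrations are the morphisms $f$ for which $ZW_s^{p,q}(f)$ is surjective for all $p,q\in\mathbb Z$ and all $s\in S$, and 3. $I_S$ and $J_S$ are the generating cofibrations and the generating acyclic cofibrations respectively. Here right proper means that pullbacks of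 weak equivalences along fibrations are weak equivalences. Finitely cofibrantly generated by $I_S$ and $J_S$ means: the domains of $I_S$ (resp. $J_S$) are small relative to the relative $I_S$-cell complexes (resp. $J_S$-cell complexes); the fibrations (resp. the acyclic fibrations) are the morphisms with the right lifting property with respect to $J_S$ (resp. $I_S$); and the domains and codomains of $I_S$ and $J_S$ are finite relative to the cofibrations, i.e. for each such object $A$ the functor $\mathrm{Hom}(A,-)$ commutes with the colimits of all $\lambda$-sequences of cofibrations, for all limit ordinals $\lambda$. -/

import Mathlib

open CategoryTheory CategoryTheory.Limits HomotopicalAlgebra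
open scoped ZeroObject

universe u v w

noncomputable section

/-! ## Bicomplexes -/

/-- Bicomplexes of `R`-modules, graded homologically in the horizontal (first) and cohomologically
in the vertical (second) direction, with commuting differentials
`d₀ : A^{i,j} → A^{i,j+1}` and `d₁ : A^{i,j} → A^{i-1,j}`. -/
abbrev Bicomplex (R : Type u) [CommRing R] :=
  HomologicalComplex₂ (ModuleCat.{u} R) (ComplexShape.down ℤ) (ComplexShape.up ℤ)

namespace Bicomplex

variable {R : Type u} [CommRing R]

/-- The module `A^{i,j}`. -/
abbrev comp (A : Bicomplex R) (i j : ℤ) : ModuleCat.{u} R := (A.X i).X j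

/-- The component `A^{i,j} → B^{i,j}` of a morphism. -/
def app {A B : Bicomplex R} (f : A ⟶ B) (i j : ℤ) : A.comp i j →ₗ[R] B.comp i j :=
  ((f.f i).f j).hom

/-- The vertical differential `d₀ : A^{i,j} → A^{i,j'}`; it is only of interest for `j' = j + 1`
(and is zero otherwise). -/
def d0 (A : Bicomplex R) (i j j' : ℤ) : A.comp i j →ₗ[R] A.comp i j' :=
  ((A.X i).d j j').hom

/-- The horizontal differential `d₁ : A^{i,j} → A^{i',j}`; it is only of interest for `i' = i - 1`
(and is zero otherwise). -/
def d1 (A : Bicomplex R) (i i' j : ℤ) : A.comp i j →ₗ[R] A.comp i' j :=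
  ((A.d i i').f j).hom

/-- The identification of `A^{i,j}` with `A^{i',j'}` when `i = i'` and `j = j'`. -/
def transport (A : Bicomplex R) {i i' j j' : ℤ} (hi : i = i') (hj : j = j') :
    A.comp i j →ₗ[R] A.comp i' j' :=
  (eqToHom (by rw [hi, hj]) : A.comp i j ⟶ A.comp i' j').hom

section lemmas

variable (A : Bicomplex R)

@[simp] lemma transport_rfl {i j : ℤ} (x : A.comp i j) : A.transport rfl rfl x = x := rfl

lemma transport_transport {i i' i'' j j' j'' : ℤ} (hi : i = i') (hj : j = j') (hi' : i' = i'')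
    (hj' : j' = j'') (x : A.comp i j) :
    A.transport hi' hj' (A.transport hi hj x) = A.transport (hi.trans hi') (hj.trans hj') x := by
  subst hi hj hi' hj'; rfl

lemma d0_transport {i i' j j' k k' : ℤ} (hi : i = i') (hj : j = j') (hk : k = k')
    (x : A.comp i j) :
    A.d0 i' j' k' (A.transport hi hj x) = A.transport hi hk (A.d0 i j k x) := by
  subst hi hj hk; rfl

lemma d1_transport {i i' j j' k k' : ℤ} (hi : i = i') (hj : j = j') (hk : k = k')
    (x : A.comp i j) :
    A.d1 i' k' j' (A.transport hi hj x) = A.transport hk hj (A.d1 i k j x) := by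
  subst hi hj hk; rfl

lemma d0_d0 (i j j' j'' : ℤ) (x : A.comp i j) : A.d0 i j' j'' (A.d0 i j j' x) = 0 :=
  congr($((A.X i).d_comp_d j j' j'').hom x)

lemma d1_d1 (i i' i'' j : ℤ) (x : A.comp i j) : A.d1 i' i'' j (A.d1 i i' j x) = 0 :=
  congr(($(A.d_comp_d i i' i'').f j).hom x)

lemma d0_d1 (i i' j j' : ℤ) (x : A.comp i j) :
    A.d0 i' j j' (A.d1 i i' j x) = A.d1 i i' j' (A.d0 i j j' x) :=
  congr($((A.d i i').comm j j').hom x)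

variable {A} {B : Bicomplex R} (f : A ⟶ B)

lemma app_d0 (i j j' : ℤ) (x : A.comp i j) :
    app f i j' (A.d0 i j j' x) = B.d0 i j j' (app f i j x) :=
  congr($((f.f i).comm j j').hom x).symm

lemma app_d1 (i i' j : ℤ) (x : A.comp i j) :
    app f i' j (A.d1 i i' j x) = B.d1 i i' j (app f i j x) :=
  congr(($(f.comm i i').f j).hom x).symm

lemma app_transport {i i' j j' : ℤ} (hi : i = i') (hj : j = j') (x : A.comp i j) :
    app f i' j' (A.transport hi hj x) = B.transport hi hj (app f i j x) := by
  subst hi hj; rfl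

end lemmas

/-! ## Witness cycles, witness boundaries, and the pages of the spectral sequence -/

/-- The submodule of tuples `(a₀, …, a_r) ∈ ⨁ A^{p-k,q-k}` with `d₀ a₀ = 0` and
`d₀ a_{k+1} = d₁ a_k`: the `(r+1)`-witness cycles in bidegree `(p, q)`. -/
def witnessTuples (A : Bicomplex R) (r : ℕ) (p q : ℤ) :
    Submodule R ((k : Fin (r + 1)) → A.comp (p - (k : ℕ)) (q - (k : ℕ))) where
  carrier := {a |
    A.d0 (p - ((0 : Fin (r + 1)) : ℕ)) (q - ((0 : Fin (r + 1)) : ℕ)) (q + 1) (a 0) = 0 ∧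
    ∀ k : Fin r,
      A.d0 (p - (k.succ : ℕ)) (q - (k.succ : ℕ)) (q - (k.castSucc : ℕ)) (a k.succ) =
      A.d1 (p - (k.castSucc : ℕ)) (p - (k.succ : ℕ)) (q - (k.castSucc : ℕ)) (a k.castSucc)}
  add_mem' := by
    rintro a b ⟨h, h'⟩ ⟨g, g'⟩
    exact ⟨by rw [Pi.add_apply, map_add, h, g, add_zero],
      fun k => by rw [Pi.add_apply, Pi.add_apply, map_add, map_add, h', g']⟩
  zero_mem' := ⟨by rw [Pi.zero_apply, map_zero], fun k => by
    rw [Pi.zero_apply, Pi.zero_apply, map_zero, map_zero]⟩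
  smul_mem' := by
    rintro c a ⟨h, h'⟩
    exact ⟨by rw [Pi.smul_apply, map_smul, h, smul_zero],
      fun k => by rw [Pi.smul_apply, Pi.smul_apply, map_smul, map_smul, h']⟩

/-- The `r`-witness cycles `ZW_r^{p,q}(A)`. -/
def ZW (A : Bicomplex R) : ℕ → ℤ → ℤ → ModuleCat.{u} R
  | 0, p, q => A.comp p q
  | r + 1, p, q => ModuleCat.of R (A.witnessTuples r p q)

/-- The map induced by a morphism of bicomplexes on tuples. -/
def tupleMap {A B : Bicomplex R} (f : A ⟶ B) (r : ℕ) (p q : ℤ) :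
    ((k : Fin (r + 1)) → A.comp (p - (k : ℕ)) (q - (k : ℕ))) →ₗ[R]
      ((k : Fin (r + 1)) → B.comp (p - (k : ℕ)) (q - (k : ℕ))) :=
  LinearMap.pi fun k => app f (p - (k : ℕ)) (q - (k : ℕ)) ∘ₗ LinearMap.proj k

lemma tupleMap_mem {A B : Bicomplex R} (f : A ⟶ B) (r : ℕ) (p q : ℤ)
    (a : (k : Fin (r + 1)) → A.comp (p - (k : ℕ)) (q - (k : ℕ))) (ha : a ∈ A.witnessTuples r p q) :
    tupleMap f r p q a ∈ B.witnessTuples r p q := by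
  obtain ⟨h, h'⟩ := ha
  refine ⟨?_, fun k => ?_⟩
  · change B.d0 _ _ _ (app f _ _ (a 0)) = 0
    rw [← app_d0, h, map_zero]
  · change B.d0 _ _ _ (app f _ _ (a k.succ)) = B.d1 _ _ _ (app f _ _ (a k.castSucc))
    rw [← app_d0, ← app_d1, h']

/-- The map induced by a morphism of bicomplexes on `r`-witness cycles. -/
def ZWMap {A B : Bicomplex R} (f : A ⟶ B) : (r : ℕ) → (p q : ℤ) → A.ZW r p q →ₗ[R] B.ZW r p q
  | 0, p, q => app f p q
  | r + 1, p, q =>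
    ((tupleMap f r p q).restrict (fun a ha => tupleMap_mem f r p q a ha) :
      A.witnessTuples r p q →ₗ[R] B.witnessTuples r p q)

/-- The `r`-witness boundaries `BW_r^{p,q}(A)`:
`BW_0^{p,q} = 0`, `BW_1^{p,q} = A^{p,q}`, and for `r ≥ 2`
`BW_r^{p,q} = ZW_{r-1}^{p+r-1,q+r-1} ⊕ A^{p,q} ⊕ ZW_{r-1}^{p-1,q}`. -/
def BW (A : Bicomplex R) : ℕ → ℤ → ℤ → ModuleCat.{u} R
  | 0, _, _ => ModuleCat.of R PUnit
  | 1, p, q => A.comp p q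
  | r + 2, p, q => ModuleCat.of R
      (A.ZW (r + 1) (p + (r + 1 : ℕ)) (q + (r + 1 : ℕ)) × A.comp p q × A.ZW (r + 1) (p - 1) q)

/-- The map induced by a morphism of bicomplexes on `r`-witness boundaries. -/
def BWMap {A B : Bicomplex R} (f : A ⟶ B) : (r : ℕ) → (p q : ℤ) → A.BW r p q →ₗ[R] B.BW r p q
  | 0, _, _ => 0
  | 1, p, q => app f p q
  | r + 2, p, q =>
    (LinearMap.prodMap (ZWMap f (r + 1) (p + (r + 1 : ℕ)) (q + (r + 1 : ℕ)))
      (LinearMap.prodMap (app f p q) (ZWMap f (r + 1) (p - 1) q)) :)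

/-- The tuple
`(d₁ b_{r} + d₀ a, d₁ a + c₀, c₁, …, c_r)`, where `b = (b₀, …, b_r)` and `c = (c₀, …, c_r)`. -/
def wTuple (A : Bicomplex R) (r : ℕ) (p : ℤ) {q q' : ℤ} (h : q + 1 = q')
    (b : (k : Fin (r + 1)) → A.comp (p + (r + 1 : ℕ) - (k : ℕ)) (q + (r + 1 : ℕ) - (k : ℕ)))
    (a : A.comp p q)
    (c : (k : Fin (r + 1)) → A.comp (p - 1 - (k : ℕ)) (q - (k : ℕ))) :
    (k : Fin (r + 2)) → A.comp (p - (k : ℕ)) (q' - (k : ℕ))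
  | ⟨0, _⟩ =>
    A.transport (by simp) (by simp; lia)
      (A.d1 (p + (r + 1 : ℕ) - ((Fin.last r : Fin (r + 1)) : ℕ)) p _ (b (Fin.last r))) +
    A.transport (by simp) (by simp) (A.d0 p q q' a)
  | ⟨1, _⟩ =>
    A.transport (by simp) (by simp; lia) (A.d1 p (p - 1) q a) +
    A.transport (by simp) (by simp; lia) (c 0)
  | ⟨k + 2, hk⟩ => A.transport (by simp; lia) (by simp; lia) (c ⟨k + 1, by lia⟩)

lemma wTuple_mem (A : Bicomplex R) (r : ℕ) (p : ℤ) {q q' : ℤ} (h : q + 1 = q')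
    (b : A.witnessTuples r (p + (r + 1 : ℕ)) (q + (r + 1 : ℕ)))
    (a : A.comp p q) (c : A.witnessTuples r (p - 1) q) :
    A.wTuple r p h b.1 a c.1 ∈ A.witnessTuples (r + 1) p q' := by
  obtain ⟨b, hb, hb'⟩ := b
  obtain ⟨c, hc, hc'⟩ := c
  subst h
  have hlast : ∀ j', A.d1 (p + (r + 1 : ℕ) - ((Fin.last r : Fin (r + 1)) : ℕ)) p j'
      (A.d0 _ _ j' (b (Fin.last r))) = 0 := by
    intro j'
    by_cases hj : q + (r + 1 : ℕ) - ((Fin.last r : Fin (r + 1)) : ℕ) + 1 = j'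
    · rcases r with _ | r
      · obtain rfl : j' = q + ((0 + 1 : ℕ) : ℤ) + 1 := by simp at hj ⊢; lia
        have hb0 := congrArg (A.d1 (p + ((0 + 1 : ℕ) : ℤ) - ((Fin.last 0 : Fin (0 + 1)) : ℕ)) p _) hb
        rw [map_zero] at hb0
        exact hb0
      · obtain rfl : j' = q + ((r + 1 + 1 : ℕ) : ℤ) - ((Fin.last r).castSucc : ℕ) := by
          simp at hj ⊢; lia
        have hb0 := hb' (Fin.last r)
        rw [Fin.succ_last] at hb0
        rw [hb0, d1_d1]
    · have : A.d0 (p + (r + 1 : ℕ) - ((Fin.last r : Fin (r + 1)) : ℕ))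
          (q + (r + 1 : ℕ) - ((Fin.last r : Fin (r + 1)) : ℕ)) j' = 0 := by
        rw [d0, HomologicalComplex.shape _ _ _ (by simpa using hj)]; rfl
      rw [this, LinearMap.zero_apply, map_zero]
  -- the equation in position `0`
  have key0 (i j k : ℤ) (ei : p = i) (ei' : p = i)
      (ej : q + (r + 1 : ℕ) - ((Fin.last r : Fin (r + 1)) : ℕ) = j) (ej' : q + 1 = j) :
      A.d0 i j k (A.transport ei ej (A.d1 (p + (r + 1 : ℕ) - ((Fin.last r : Fin (r + 1)) : ℕ)) p _
        (b (Fin.last r))) + A.transport ei' ej' (A.d0 p q (q + 1) a)) = 0 := by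
    rw [map_add, A.d0_transport _ _ rfl, A.d0_transport _ _ rfl, d0_d0, d0_d1, hlast, map_zero,
      add_zero]
  -- the equation in position `1`
  have key1 (i i' j j' : ℤ) (ei : p = i) (ei' : p = i)
      (ej : q + (r + 1 : ℕ) - ((Fin.last r : Fin (r + 1)) : ℕ) = j) (ej' : q + 1 = j)
      (fi : p - 1 = i') (fj : q = j') (fi' : p - 1 - ((0 : Fin (r + 1)) : ℕ) = i')
      (fj' : q - ((0 : Fin (r + 1)) : ℕ) = j') :
      A.d0 i' j' j (A.transport fi fj (A.d1 p (p - 1) q a) + A.transport fi' fj' (c 0)) =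
      A.d1 i i' j (A.transport ei ej
        (A.d1 (p + (r + 1 : ℕ) - ((Fin.last r : Fin (r + 1)) : ℕ)) p _
        (b (Fin.last r))) + A.transport ei' ej' (A.d0 p q (q + 1) a)) := by
    rw [map_add, map_add, A.d0_transport _ _ ej', A.d0_transport _ _ ej', A.d1_transport _ _ fi,
      A.d1_transport _ _ fi, hc, d1_d1, d0_d1, map_zero, map_zero, add_zero, zero_add]
  -- the equation in position `k + 2`
  have key2 (k : Fin r) (i i' j j' : ℤ)
      (ei : p - 1 - (k.castSucc : ℕ) = i) (ej : q - (k.castSucc : ℕ) = j)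
      (fi : p - 1 - (k.succ : ℕ) = i') (fj : q - (k.succ : ℕ) = j') :
      A.d0 i' j' j (A.transport fi fj (c k.succ)) =
      A.d1 i i' j (A.transport ei ej (c k.castSucc)) := by
    rw [A.d0_transport _ _ ej, A.d1_transport _ _ fi, hc']
  have key3 (i i' j j' : ℤ) (hk : 0 < r)
      (ei : p - 1 = i) (ej : q = j) (ei' : p - 1 - ((0 : Fin (r + 1)) : ℕ) = i)
      (ej' : q - ((0 : Fin (r + 1)) : ℕ) = j) (fi : p - 1 - ((⟨0, hk⟩ : Fin r).succ : ℕ) = i')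
      (fj : q - ((⟨0, hk⟩ : Fin r).succ : ℕ) = j') :
      A.d0 i' j' j (A.transport fi fj (c (⟨0, hk⟩ : Fin r).succ)) =
      A.d1 i i' j (A.transport ei ej (A.d1 p (p - 1) q a) + A.transport ei' ej' (c 0)) := by
    rw [map_add, A.d1_transport ei ej fi, d1_d1, map_zero, zero_add]
    exact key2 ⟨0, hk⟩ i i' j j' ei' ej' fi fj
  refine ⟨key0 _ _ _ _ _ _ _, fun k => ?_⟩
  match k with
  | ⟨0, _⟩ => exact key1 _ _ _ _ _ _ _ _ _ _ _ _
  | ⟨1, hk⟩ =>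
    exact key3 (p - ((⟨1, hk⟩ : Fin (r + 1)).castSucc : ℕ)) (p - ((⟨1, hk⟩ : Fin (r + 1)).succ : ℕ))
      (q + 1 - ((⟨1, hk⟩ : Fin (r + 1)).castSucc : ℕ)) (q + 1 - ((⟨1, hk⟩ : Fin (r + 1)).succ : ℕ))
      (by omega) (by simp) (by simp) (by simp) (by simp) (by simp; omega) (by simp; omega)
  | ⟨k + 2, hk⟩ =>
    exact key2 ⟨k + 1, by omega⟩
      (p - ((⟨k + 2, hk⟩ : Fin (r + 1)).castSucc : ℕ))
      (p - ((⟨k + 2, hk⟩ : Fin (r + 1)).succ : ℕ))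
      (q + 1 - ((⟨k + 2, hk⟩ : Fin (r + 1)).castSucc : ℕ))
      (q + 1 - ((⟨k + 2, hk⟩ : Fin (r + 1)).succ : ℕ))
      (by simp; omega) (by simp; omega) (by simp; omega) (by simp; omega)

lemma wTuple_add (A : Bicomplex R) (r : ℕ) (p : ℤ) {q q' : ℤ} (h : q + 1 = q')
    (b b' : (k : Fin (r + 1)) → A.comp (p + (r + 1 : ℕ) - (k : ℕ)) (q + (r + 1 : ℕ) - (k : ℕ)))
    (a a' : A.comp p q) (c c' : (k : Fin (r + 1)) → A.comp (p - 1 - (k : ℕ)) (q - (k : ℕ))) :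
    A.wTuple r p h (b + b') (a + a') (c + c') = A.wTuple r p h b a c + A.wTuple r p h b' a' c' := by
  funext k
  match k with
  | ⟨0, _⟩ =>
    simp only [wTuple, Pi.add_apply, map_add]
    abel
  | ⟨1, _⟩ =>
    simp only [wTuple, Pi.add_apply, map_add]
    abel
  | ⟨k + 2, hk⟩ => simp only [wTuple, Pi.add_apply, map_add]

lemma wTuple_smul (A : Bicomplex R) (r : ℕ) (p : ℤ) {q q' : ℤ} (h : q + 1 = q') (t : R)
    (b : (k : Fin (r + 1)) → A.comp (p + (r + 1 : ℕ) - (k : ℕ)) (q + (r + 1 : ℕ) - (k : ℕ)))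
    (a : A.comp p q) (c : (k : Fin (r + 1)) → A.comp (p - 1 - (k : ℕ)) (q - (k : ℕ))) :
    A.wTuple r p h (t • b) (t • a) (t • c) = t • A.wTuple r p h b a c := by
  funext k
  match k with
  | ⟨0, _⟩ => simp only [wTuple, Pi.smul_apply, map_smul, smul_add]
  | ⟨1, _⟩ => simp only [wTuple, Pi.smul_apply, map_smul, smul_add]
  | ⟨k + 2, hk⟩ => simp only [wTuple, Pi.smul_apply, map_smul]

/-- The map `w_r : BW_r^{p,q}(A) → ZW_r^{p,q+1}(A)`: it is `0` for `r = 0`, it is `d₀` for `r = 1`,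
and for `r ≥ 2` it sends `((b₀, …, b_{r-2}), a, (c₀, …, c_{r-2}))` to
`(d₁ b_{r-2} + d₀ a, d₁ a + c₀, c₁, …, c_{r-2})`. -/
def wMap (A : Bicomplex R) : (r : ℕ) → (p : ℤ) → {q q' : ℤ} → (q + 1 = q') →
    A.BW r p q →ₗ[R] A.ZW r p q'
  | 0, _, _, _, _ => 0
  | 1, p, q, q', _ =>
    (LinearMap.codRestrict (A.witnessTuples 0 p q')
      (LinearMap.pi fun k : Fin 1 =>
        A.transport (by simp) (by simp) ∘ₗ A.d0 p q q')
      (by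
        intro a
        refine ⟨?_, fun k => k.elim0⟩
        simp only [LinearMap.pi_apply, LinearMap.comp_apply]
        rw [A.d0_transport _ _ rfl, d0_d0, map_zero]) :)
  | r + 2, p, _, _, h =>
    ({ toFun := fun x => ⟨A.wTuple r p h x.1.1 x.2.1 x.2.2.1, A.wTuple_mem r p h x.1 x.2.1 x.2.2⟩
       map_add' := fun x y => Subtype.ext (A.wTuple_add r p h _ _ _ _ _ _)
       map_smul' := fun t x => Subtype.ext (A.wTuple_smul r p h t _ _ _) } :
      (A.witnessTuples r (p + (r + 1 : ℕ)) _ × A.comp p _ × A.witnessTuples r (p - 1) _) →ₗ[R]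
        A.witnessTuples (r + 1) p _)

lemma ZWMap_wMap {A B : Bicomplex R} (f : A ⟶ B) (r : ℕ) (p : ℤ) {q q' : ℤ} (h : q + 1 = q')
    (x : A.BW r p q) :
    ZWMap f r p q' (A.wMap r p h x) = B.wMap r p h (BWMap f r p q x) := by
  match r with
  | 0 => exact map_zero _
  | 1 =>
    refine Subtype.ext (funext fun k => ?_)
    change app f _ _ (A.transport _ _ (A.d0 p q q' x)) =
      B.transport _ _ (B.d0 p q q' (app f p q x))
    exact (app_transport f _ _ _).trans (congrArg _ (app_d0 f _ _ _ _))
  | r + 2 =>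
    obtain ⟨b, a, c⟩ := x
    refine Subtype.ext (funext fun k => ?_)
    change app f _ _ (A.wTuple r p h b.1 a c.1 k) =
      B.wTuple r p h (tupleMap f _ _ _ b.1) (app f p q a) (tupleMap f _ _ _ c.1) k
    match k with
    | ⟨0, _⟩ =>
      simp only [wTuple, map_add, app_transport, app_d0, app_d1]
      rfl
    | ⟨1, _⟩ =>
      simp only [wTuple, map_add, app_transport, app_d1]
      rfl
    | ⟨k + 2, hk⟩ =>
      simp only [wTuple, app_transport]
      rfl

/-- The submodule `w_r(BW_r^{p,q-1}(A))` of `ZW_r^{p,q}(A)`. -/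
def boundaries (A : Bicomplex R) (r : ℕ) (p q : ℤ) : Submodule R (A.ZW r p q) :=
  LinearMap.range (A.wMap r p (sub_add_cancel q 1))

/-- The component `E_r^{p,q}(A) = ZW_r^{p,q}(A) / w_r(BW_r^{p,q-1}(A))` of the `r`-page of the
spectral sequence associated with the bicomplex `A`. -/
abbrev page (A : Bicomplex R) (r : ℕ) (p q : ℤ) : Type u :=
  A.ZW r p q ⧸ A.boundaries r p q

/-- The map induced by a morphism of bicomplexes on the `r`-pages. -/
def pageMap {A B : Bicomplex R} (f : A ⟶ B) (r : ℕ) (p q : ℤ) :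
    A.page r p q →ₗ[R] B.page r p q :=
  Submodule.mapQ _ _ (ZWMap f r p q) (by
    rintro _ ⟨x, rfl⟩
    exact ⟨BWMap f r p (q - 1) x, (ZWMap_wMap f r p _ x).symm⟩)

/-- The `r`-quasi-isomorphisms: the morphisms of bicomplexes which induce an isomorphism between
the `(r+1)`-pages of the associated spectral sequences. -/
def rQuasiIso (R : Type u) [CommRing R] (r : ℕ) : MorphismProperty (Bicomplex R) :=
  fun _ _ f => ∀ p q : ℤ, Function.Bijective (pageMap f (r + 1) p q)

/-- The morphisms which are `ZW_s`-bidegreewise surjective for all `s ∈ S`. -/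
def ZWSurjective (R : Type u) [CommRing R] (S : Set ℕ) : MorphismProperty (Bicomplex R) :=
  fun _ _ f => ∀ s ∈ S, ∀ p q : ℤ, Function.Surjective (ZWMap f s p q)

end Bicomplex

/-! ## The representing bicomplexes -/

/-- The combinatorial datum of a bicomplex which is bidegreewise free on a bigraded set of
generators, and both of whose differentials send every generator either to a generator (`some`) or
to zero (`none`). These are the bicomplexes that one draws as diagrams of dots and arrows. -/
structure BicomplexDiagram where
  /-- the generators (the dots) -/
  Gen : Type
  /-- the bidegree of a generator -/
  deg : Gen → ℤ × ℤ
  /-- the vertical differential -/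
  d0 : Gen → Option Gen
  /-- the horizontal differential -/
  d1 : Gen → Option Gen
  deg_d0 : ∀ g, ∀ h ∈ d0 g, deg h = ((deg g).1, (deg g).2 + 1)
  deg_d1 : ∀ g, ∀ h ∈ d1 g, deg h = ((deg g).1 - 1, (deg g).2)
  d0_d0 : ∀ g, (d0 g).bind d0 = none
  d1_d1 : ∀ g, (d1 g).bind d1 = none
  comm : ∀ g, (d1 g).bind d0 = (d0 g).bind d1

namespace BicomplexDiagram

/-- The free module on the generators of bidegree `s`. -/
abbrev Mod (R : Type u) [CommRing R] (D : BicomplexDiagram) (s : ℤ × ℤ) : Type u :=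
  {g // D.deg g = s} →₀ R

variable (R : Type u) [CommRing R]

/-- The basis vector of a generator, seen in bidegree `s`
(and zero for `none` and for generators of another bidegree). -/
def vec (D : BicomplexDiagram) (s : ℤ × ℤ) : Option D.Gen → D.Mod R s
  | none => 0
  | some g => if h : D.deg g = s then Finsupp.single ⟨g, h⟩ 1 else 0

/-- The linear map in bidegrees `(s, t)` which sends the generator `g` to `F g`. -/
def lin {D D' : BicomplexDiagram} (F : D.Gen → Option D'.Gen) (s t : ℤ × ℤ) :
    D.Mod R s →ₗ[R] D'.Mod R t :=
  Finsupp.linearCombination R fun g : {g // D.deg g = s} => D'.vec R t (F g.1)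

variable {R}

lemma vec_eq_zero {D : BicomplexDiagram} {s : ℤ × ℤ} {o : Option D.Gen}
    (h : ∀ g ∈ o, D.deg g ≠ s) : D.vec R s o = 0 := by
  cases o with
  | none => rfl
  | some g => exact dif_neg (h g rfl)

lemma lin_vec {D D' : BicomplexDiagram} (F : D.Gen → Option D'.Gen) (s t : ℤ × ℤ)
    (o : Option D.Gen) (h : ∀ g ∈ o, D.deg g ≠ s → ∀ g' ∈ F g, D'.deg g' ≠ t) :
    lin R F s t (D.vec R s o) = D'.vec R t (o.bind F) := by
  cases o with
  | none => exact map_zero _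
  | some g =>
    by_cases hg : D.deg g = s
    · simp [vec, hg, lin]
    · rw [vec_eq_zero (by rintro _ ⟨⟩; exact hg), map_zero, Option.bind_some,
        vec_eq_zero (h g rfl hg)]

lemma lin_single {D D' : BicomplexDiagram} (F : D.Gen → Option D'.Gen) (s t : ℤ × ℤ)
    (g : {g // D.deg g = s}) : lin R F s t (Finsupp.single g 1) = D'.vec R t (F g.1) := by
  simp [lin]

lemma lin_eq_zero {D D' : BicomplexDiagram} (F : D.Gen → Option D'.Gen) (s t : ℤ × ℤ)
    (h : ∀ g, D.deg g = s → ∀ g' ∈ F g, D'.deg g' ≠ t) : lin R F s t = 0 := by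
  refine Finsupp.lhom_ext' fun g => LinearMap.ext_ring ?_
  change lin R F s t (Finsupp.single g 1) = 0
  rw [lin_single, vec_eq_zero (h g.1 g.2)]

lemma lin_comp_lin {D D' D'' : BicomplexDiagram} (F : D.Gen → Option D'.Gen)
    (G : D'.Gen → Option D''.Gen) (s t u : ℤ × ℤ)
    (h : ∀ g, D.deg g = s → ∀ g' ∈ F g, D'.deg g' ≠ t → ∀ g'' ∈ G g', D''.deg g'' ≠ u) :
    lin R G t u ∘ₗ lin R F s t = lin R (fun g => (F g).bind G) s u := by
  refine Finsupp.lhom_ext' fun g => LinearMap.ext_ring ?_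
  simp only [LinearMap.comp_apply, Finsupp.lsingle_apply]
  rw [lin_single, lin_single, lin_vec _ _ _ _ (h g.1 g.2)]

variable (R)

/-- The bicomplex of free `R`-modules described by a diagram. -/
def toBicomplex (D : BicomplexDiagram) : Bicomplex R :=
  HomologicalComplex₂.ofGradedObject (ComplexShape.down ℤ) (ComplexShape.up ℤ)
    (fun s => ModuleCat.of R (D.Mod R s))
    (fun i i' j => ModuleCat.ofHom (lin R D.d1 (i, j) (i', j)))
    (fun i j j' => ModuleCat.ofHom (lin R D.d0 (i, j) (i, j')))
    (fun i i' hi j => by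
      rw [lin_eq_zero]
      · rfl
      · intro g hg g' hg' he
        rw [D.deg_d1 g g' hg', hg, Prod.mk.injEq] at he
        exact hi (show i' + 1 = i by lia))
    (fun i j j' hj => by
      rw [lin_eq_zero]
      · rfl
      · intro g hg g' hg' he
        rw [D.deg_d0 g g' hg', hg, Prod.mk.injEq] at he
        exact hj (show j + 1 = j' by lia))
    (fun i i' i'' j => by
      rw [← ModuleCat.ofHom_comp, lin_comp_lin]
      · rw [lin_eq_zero]
        · rfl
        · intro g _ g' hg'
          rw [D.d1_d1 g] at hg'
          cases hg'
      · intro g _ g' hg' _ g'' hg''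
        have := D.d1_d1 g
        rw [hg', Option.bind_some, hg''] at this
        cases this)
    (fun i j j' j'' => by
      rw [← ModuleCat.ofHom_comp, lin_comp_lin]
      · rw [lin_eq_zero]
        · rfl
        · intro g _ g' hg'
          rw [D.d0_d0 g] at hg'
          cases hg'
      · intro g _ g' hg' _ g'' hg''
        have := D.d0_d0 g
        rw [hg', Option.bind_some, hg''] at this
        cases this)
    (fun i i' j j' => by
      rw [← ModuleCat.ofHom_comp, ← ModuleCat.ofHom_comp, lin_comp_lin, lin_comp_lin]
      · simp only [D.comm]
      · intro g hg g' hg' hne g'' hg'' he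
        rw [D.deg_d1 g' g'' hg'', D.deg_d0 g g' hg', hg, Prod.mk.injEq] at he
        rw [D.deg_d0 g g' hg', hg] at hne
        exact hne (Prod.ext rfl he.2)
      · intro g hg g' hg' hne g'' hg'' he
        rw [D.deg_d0 g' g'' hg'', D.deg_d1 g g' hg', hg, Prod.mk.injEq] at he
        rw [D.deg_d1 g g' hg', hg] at hne
        exact hne (Prod.ext he.1 rfl))

/-- The morphism of bicomplexes given by sending each generator to a generator of the same bidegree
or to zero, compatibly with the differentials. -/
def toBicomplexMap {D D' : BicomplexDiagram} (F : D.Gen → Option D'.Gen)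
    (deg_F : ∀ g, ∀ h ∈ F g, D'.deg h = D.deg g)
    (F_d0 : ∀ g, (F g).bind D'.d0 = (D.d0 g).bind F)
    (F_d1 : ∀ g, (F g).bind D'.d1 = (D.d1 g).bind F) :
    D.toBicomplex R ⟶ D'.toBicomplex R :=
  HomologicalComplex₂.homMk (fun s => ModuleCat.ofHom (lin R F (s.1, s.2) (s.1, s.2)))
    (fun i i' j hi => by
      change ModuleCat.ofHom (lin R F (i, j) (i, j)) ≫ ModuleCat.ofHom (lin R D'.d1 (i, j) (i', j))
        = ModuleCat.ofHom (lin R D.d1 (i, j) (i', j)) ≫ ModuleCat.ofHom (lin R F (i', j) (i', j))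
      rw [← ModuleCat.ofHom_comp, ← ModuleCat.ofHom_comp, lin_comp_lin, lin_comp_lin]
      · simp only [F_d1]
      · intro g hg g' hg' hne g'' hg'' he
        exact hne ((deg_F g' g'' hg'').symm.trans he)
      · intro g hg g' hg' hne
        exact (hne ((deg_F g g' hg').trans hg)).elim)
    (fun i j j' hj => by
      change ModuleCat.ofHom (lin R F (i, j) (i, j)) ≫ ModuleCat.ofHom (lin R D'.d0 (i, j) (i, j'))
        = ModuleCat.ofHom (lin R D.d0 (i, j) (i, j')) ≫ ModuleCat.ofHom (lin R F (i, j') (i, j'))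
      rw [← ModuleCat.ofHom_comp, ← ModuleCat.ofHom_comp, lin_comp_lin, lin_comp_lin]
      · simp only [F_d0]
      · intro g hg g' hg' hne g'' hg'' he
        exact hne ((deg_F g' g'' hg'').symm.trans he)
      · intro g hg g' hg' hne
        exact (hne ((deg_F g g' hg').trans hg)).elim)

end BicomplexDiagram

namespace Bicomplex

/-- The generators of the square `𝒵𝒲₀(p, q)`. -/
inductive SquareGen : Type
  | x
  | d0x
  | d1x
  | d0d1x

/-- The square: a generator `x` in bidegree `(p, q)`, together with `d₀ x`, `d₁ x` and
`d₀ d₁ x = d₁ d₀ x`. -/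
def squareDiagram (p q : ℤ) : BicomplexDiagram where
  Gen := SquareGen
  deg
    | .x => (p, q)
    | .d0x => (p, q + 1)
    | .d1x => (p - 1, q)
    | .d0d1x => (p - 1, q + 1)
  d0
    | .x => some .d0x
    | .d0x => none
    | .d1x => some .d0d1x
    | .d0d1x => none
  d1
    | .x => some .d1x
    | .d0x => some .d0d1x
    | .d1x => none
    | .d0d1x => none
  deg_d0 := by rintro (_ | _ | _ | _) _ ⟨⟩ <;> rfl
  deg_d1 := by rintro (_ | _ | _ | _) _ ⟨⟩ <;> rfl
  d0_d0 := by rintro (_ | _ | _ | _) <;> rfl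
  d1_d1 := by rintro (_ | _ | _ | _) <;> rfl
  comm := by rintro (_ | _ | _ | _) <;> rfl

/-- The generators of the staircase `𝒵𝒲_{r+1}(p, q)`. -/
inductive StairGen (r : ℕ) : Type
  | a (k : Fin (r + 1))
  | b (k : Fin (r + 1))

/-- The staircase: generators `a_k` in bidegree `(p - k, q - k)` and `b_k` in bidegree
`(p - k - 1, q - k)`, for `0 ≤ k ≤ r`, with `d₁ a_k = b_k`, `d₀ a₀ = 0`, `d₀ a_{k+1} = b_k`. -/
def stairDiagram (r : ℕ) (p q : ℤ) : BicomplexDiagram where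
  Gen := StairGen r
  deg
    | .a k => (p - (k : ℕ), q - (k : ℕ))
    | .b k => (p - (k : ℕ) - 1, q - (k : ℕ))
  d0
    | .a ⟨0, _⟩ => none
    | .a ⟨k + 1, hk⟩ => some (.b ⟨k, by lia⟩)
    | .b _ => none
  d1
    | .a k => some (.b k)
    | .b _ => none
  deg_d0 := by
    rintro (⟨_ | k, hk⟩ | _) _ ⟨⟩
    ext <;> simp <;> lia
  deg_d1 := by rintro (_ | _) _ ⟨⟩; rfl
  d0_d0 := by rintro (⟨_ | k, hk⟩ | _) <;> rfl
  d1_d1 := by rintro (_ | _) <;> rfl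
  comm := by rintro (⟨_ | k, hk⟩ | _) <;> rfl

variable (R : Type u) [CommRing R]

/-- The bicomplex `𝒵𝒲_r(p, q)`, which represents the functor `ZW_r^{p,q}`. -/
def repZW : ℕ → ℤ → ℤ → Bicomplex R
  | 0, p, q => (squareDiagram p q).toBicomplex R
  | r + 1, p, q => (stairDiagram r p q).toBicomplex R

/-- The bicomplex `ℬ𝒲_r(p, q)`, which represents the functor `BW_r^{p,q}`. -/
def repBW : ℕ → ℤ → ℤ → Bicomplex R
  | 0, _, _ => 0
  | 1, p, q => repZW R 0 p q
  | r + 2, p, q =>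
    repZW R (r + 1) (p + (r + 1 : ℕ)) (q + (r + 1 : ℕ)) ⊞
      (repZW R 0 p q ⊞ repZW R (r + 1) (p - 1) q)

/-- The morphism `𝒵𝒲_{r+1}(p, q + 1) ⟶ 𝒵𝒲₀(p, q)` with `a₀ ↦ d₀ x`, `a₁ ↦ d₁ x` (so that
`b₀ ↦ d₀ d₁ x`), all other generators being sent to zero. -/
def stairToSquare (r : ℕ) (p : ℤ) {q q' : ℤ} (h : q + 1 = q') :
    (stairDiagram r p q').toBicomplex R ⟶ (squareDiagram p q).toBicomplex R :=
  BicomplexDiagram.toBicomplexMap R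
    (fun
      | .a ⟨0, _⟩ => some .d0x
      | .a ⟨1, _⟩ => some .d1x
      | .a ⟨_ + 2, _⟩ => none
      | .b ⟨0, _⟩ => some .d0d1x
      | .b ⟨_ + 1, _⟩ => none)
    (by
      subst h
      rintro (⟨_ | _ | k, hk⟩ | ⟨_ | k, hk⟩) _ ⟨⟩ <;> ext <;> simp [stairDiagram, squareDiagram])
    (by rintro (⟨_ | _ | k, hk⟩ | ⟨_ | k, hk⟩) <;> rfl)
    (by rintro (⟨_ | _ | k, hk⟩ | ⟨_ | k, hk⟩) <;> rfl)

/-- The morphism `𝒵𝒲_{r+2}(p, q + 1) ⟶ 𝒵𝒲_{r+1}(p + r + 1, q + r + 1)` which sends `a₀` to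
`b_r = d₁ a_r` and all other generators to zero. -/
def stairToUpper (r : ℕ) (p : ℤ) {q q' : ℤ} (h : q + 1 = q') :
    (stairDiagram (r + 1) p q').toBicomplex R ⟶
      (stairDiagram r (p + (r + 1 : ℕ)) (q + (r + 1 : ℕ))).toBicomplex R :=
  BicomplexDiagram.toBicomplexMap R
    (fun
      | .a ⟨0, _⟩ => some (.b (Fin.last r))
      | .a ⟨_ + 1, _⟩ => none
      | .b _ => none)
    (by
      subst h
      rintro (⟨_ | k, hk⟩ | _) _ ⟨⟩
      ext <;> simp [stairDiagram] <;> lia)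
    (by rintro (⟨_ | k, hk⟩ | _) <;> rfl)
    (by rintro (⟨_ | k, hk⟩ | _) <;> rfl)

/-- The morphism `𝒵𝒲_{r+2}(p, q + 1) ⟶ 𝒵𝒲_{r+1}(p - 1, q)` with `a_{k+1} ↦ a_k`,
`b_{k+1} ↦ b_k`, and `a₀, b₀ ↦ 0`. -/
def stairToLower (r : ℕ) (p : ℤ) {q q' : ℤ} (h : q + 1 = q') :
    (stairDiagram (r + 1) p q').toBicomplex R ⟶
      (stairDiagram r (p - 1) q).toBicomplex R :=
  BicomplexDiagram.toBicomplexMap R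
    (fun
      | .a ⟨0, _⟩ => none
      | .a ⟨k + 1, hk⟩ => some (.a ⟨k, by lia⟩)
      | .b ⟨0, _⟩ => none
      | .b ⟨k + 1, hk⟩ => some (.b ⟨k, by lia⟩))
    (by
      subst h
      rintro (⟨_ | k, hk⟩ | ⟨_ | k, hk⟩) _ ⟨⟩ <;> ext <;> simp [stairDiagram] <;> lia)
    (by rintro (⟨_ | _ | k, hk⟩ | ⟨_ | k, hk⟩) <;> rfl)
    (by rintro (⟨_ | k, hk⟩ | ⟨_ | k, hk⟩) <;> rfl)

/-- The morphism `φ_r : 𝒵𝒲_r(p, q + 1) ⟶ ℬ𝒲_r(p, q)`, which induces `w_r`. -/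
def phi : (r : ℕ) → (p : ℤ) → {q q' : ℤ} → (q + 1 = q') → (repZW R r p q' ⟶ repBW R r p q)
  | 0, _, _, _, _ => 0
  | 1, p, _, _, h => stairToSquare R 0 p h
  | r + 2, p, _, _, h =>
    biprod.lift (stairToUpper R r p h)
      (biprod.lift (stairToSquare R (r + 1) p h) (stairToLower R r p h))

/-- The set `I_r` of the morphisms `φ_{r+1} : 𝒵𝒲_{r+1}(p, q) ⟶ ℬ𝒲_{r+1}(p, q - 1)`. -/
def setIr (r : ℕ) : MorphismProperty (Bicomplex R) :=
  MorphismProperty.ofHoms fun pq : ℤ × ℤ => phi R (r + 1) pq.1 (sub_add_cancel pq.2 1)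

/-- The set `J_r` of the morphisms `0 ⟶ 𝒵𝒲_r(p, q)` and `0 ⟶ 𝒵𝒲₀(p, q)`. -/
def setJr (r : ℕ) : MorphismProperty (Bicomplex R) :=
  (MorphismProperty.ofHoms fun pq : ℤ × ℤ => (0 : (0 : Bicomplex R) ⟶ repZW R r pq.1 pq.2)) ⊔
  (MorphismProperty.ofHoms fun pq : ℤ × ℤ => (0 : (0 : Bicomplex R) ⟶ repZW R 0 pq.1 pq.2))

/-- The set `J_S`, the union of the sets `J_s` for `s ∈ S`. -/
def setJ (S : Set ℕ) : MorphismProperty (Bicomplex R) := ⨆ s ∈ S, setJr R s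

/-- The set `I_S`, the union of `I_r` and of the sets `J_s` for `s ∈ S`. -/
def setI (r : ℕ) (S : Set ℕ) : MorphismProperty (Bicomplex R) := setIr R r ⊔ ⨆ s ∈ S, setJr R s

end Bicomplex

/-! ## Model categories -/

section ModelCategories

variable {C : Type u} [Category.{v} C]

/-- Let `κ` be a cardinal. The object `A` is `κ`-small relative to the class of morphisms `D` if
`Hom(A, -)` commutes with the colimits of all `λ`-sequences `X₀ → X₁ → ⋯` whose maps `X_β → X_{β+1}`
are in `D`, for all `κ`-filtered ordinals `λ` (i.e. limit ordinals `λ` in which every subset of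
cardinality at most `κ` is bounded). The ordinals `λ` are here well-ordered types `J` without
a greatest element. -/
def IsSmallRelTo (κ : Cardinal.{v}) (D : MorphismProperty C) (A : C) : Prop :=
  ∀ (J : Type v) [LinearOrder J] [SuccOrder J] [OrderBot J] [WellFoundedLT J] [NoMaxOrder J],
    (∀ T : Set J, Cardinal.mk T ≤ κ → BddAbove T) →
    ∀ (F : J ⥤ C) [F.IsWellOrderContinuous],
      (∀ j : J, D (F.map (homOfLE (Order.le_succ j)))) →
      PreservesColimit F (coyoneda.obj (Opposite.op A))

/-- The object `A` is small relative to `D`: it is `κ`-small relative to `D` for some `κ`. -/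
def IsSmallObjRelTo (D : MorphismProperty C) (A : C) : Prop :=
  ∃ κ : Cardinal.{v}, IsSmallRelTo κ D A

/-- The object `A` is finite relative to `D`: it is `κ`-small relative to `D` for some finite
cardinal `κ`. -/
def IsFiniteObjRelTo (D : MorphismProperty C) (A : C) : Prop :=
  ∃ κ : Cardinal.{v}, κ < Cardinal.aleph0 ∧ IsSmallRelTo κ D A

/-- The relative `I`-cell complexes: transfinite compositions of pushouts of elements of `I`. -/
def relCell (I : MorphismProperty C) : MorphismProperty C :=
  MorphismProperty.transfiniteCompositions.{v} I.pushouts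

variable (C)

/-- The model category `C` is complete and cocomplete, and has functorial factorizations. -/
structure IsFunctorialModelCategory [ModelCategory C] : Prop where
  hasLimits : HasLimits C
  hasColimits : HasColimits C
  functorial_trivCof_fib :
    (trivialCofibrations C).HasFunctorialFactorization (fibrations C)
  functorial_cof_trivFib :
    (cofibrations C).HasFunctorialFactorization (trivialFibrations C)

/-- The model category `C` is right proper: pullbacks of weak equivalences along fibrations are
weak equivalences. -/
def IsRightProper [ModelCategory C] : Prop :=
  ∀ ⦃P X Y B : C⦄ (fst : P ⟶ X) (snd : P ⟶ Y) (p : X ⟶ B) (w : Y ⟶ B),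
    IsPullback fst snd p w → fibrations C p → weakEquivalences C w → weakEquivalences C fst

/-- The model category `C` is cofibrantly generated, with `I` as set of generating cofibrations and
`J` as set of generating acyclic cofibrations. -/
structure IsCofibrantlyGeneratedBy [ModelCategory C] (I J : MorphismProperty C) : Prop where
  isSmall_I : MorphismProperty.IsSmall.{v} I
  isSmall_J : MorphismProperty.IsSmall.{v} J
  small_I : ∀ ⦃X Y : C⦄ (i : X ⟶ Y), I i → IsSmallObjRelTo (relCell I) X
  small_J : ∀ ⦃X Y : C⦄ (j : X ⟶ Y), J j → IsSmallObjRelTo (relCell J) X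
  fibrations_eq : fibrations C = J.rlp
  trivialFibrations_eq : trivialFibrations C = I.rlp

/-- The model category `C` is finitely cofibrantly generated by `I` and `J`: moreover the domains
and codomains of `I` and `J` are finite relative to the cofibrations. -/
structure IsFinitelyCofibrantlyGeneratedBy [ModelCategory C] (I J : MorphismProperty C) : Prop
    extends IsCofibrantlyGeneratedBy C I J where
  finite_I : ∀ ⦃X Y : C⦄ (i : X ⟶ Y), I i →
    IsFiniteObjRelTo (cofibrations C) X ∧ IsFiniteObjRelTo (cofibrations C) Y
  finite_J : ∀ ⦃X Y : C⦄ (j : X ⟶ Y), J j →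
    IsFiniteObjRelTo (cofibrations C) X ∧ IsFiniteObjRelTo (cofibrations C) Y

end ModelCategories

end

/-! By representability, lifting problems against the generators become statements about elements.
The universal witness cycle is sent by `phi` to the image under w of the universal witness boundary
(`wMap_univBW`). So lifting f against 0 → 𝒵𝒲_s means surjectivity of ZW_s(f), and lifting f : A → B
against φ_{r+1} means surjectivity of BW_{r+1}(A) → ZW_{r+1}(A) ×_{ZW_{r+1}(B)} BW_{r+1}(B).

The link with the spectral sequence is the natural exact sequence 0 → ZW_{r+1}^{p+r,q+r} →
BW_{r+1}^{p,q} → ZW_{r+1}^{p,q+1} → E_{r+1}^{p,q+1} → 0, whose first map is `toKer` and whose second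
map is w. If f is surjective on ZW_0 and ZW_r, it is surjective on BW_{r+1}, and a diagram chase
shows that lifting against I_r is the same as being an isomorphism on E_{r+1}
(`setIr_rlp_iff_rQuasiIso`). Hence the I_S-injectives are the J_S-injectives which are weak
equivalences (`setI_rlp`).

It remains to see that J_S-cofibrations are weak equivalences. No analysis of cell complexes is
needed. Every Y admits a map π : Q → Y, surjective on ZW_s for all s ≤ r, with E_{r+1}(Q) = 0: take
Q to be a sum of squares and of staircases of length at most r with coefficients in Y
(`exists_pageIsZero_surjective`). If f : X → Y lifts against J_S-injectives, lift it against (f, π)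
: X ⊕ Q → Y. The lift gives a retraction g of f such that the identity of Y is f ∘ g plus a map
factoring through Q (`exists_section_of_llp`). That second map vanishes on E_{r+1}, so f and g are
inverse there.

The retract argument then identifies acyclic cofibrations with J_S-cofibrations. The generators are
described by finite diagrams, hence are finitely presentable, which gives the small object argument
and all finiteness claims. For right properness, w is factored as a J_S-cofibration followed by an
acyclic fibration. The second factor is stable under pullback, and the splitting above, with Q also
J_S-cofibrant, pulls back along a fibration. -/

noncomputable section

/-! ### Morphisms out of the bicomplex of a diagram -/

namespace BicomplexDiagram

variable {R : Type u} [CommRing R] (D : BicomplexDiagram) {A : Bicomplex R}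

/-- The element of `A` assigned to a generator or to zero, seen in bidegree `s`. -/
def val (t : ∀ s : ℤ × ℤ, {g // D.deg g = s} → A.comp s.1 s.2) (s : ℤ × ℤ) :
    Option D.Gen → A.comp s.1 s.2
  | none => 0
  | some g => if h : D.deg g = s then t s ⟨g, h⟩ else 0

lemma val_some (t : ∀ s : ℤ × ℤ, {g // D.deg g = s} → A.comp s.1 s.2) {s : ℤ × ℤ} {g : D.Gen}
    (h : D.deg g = s) : D.val t s (some g) = t s ⟨g, h⟩ :=
  dif_pos h

lemma linearCombination_vec (t : ∀ s : ℤ × ℤ, {g // D.deg g = s} → A.comp s.1 s.2)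
    (s : ℤ × ℤ) (o : Option D.Gen) :
    Finsupp.linearCombination R (t s) (D.vec R s o) = D.val t s o := by
  cases o with
  | none => exact map_zero _
  | some g =>
    by_cases hg : D.deg g = s
    · simp [vec, val, hg]
    · simp [vec, val, hg]

/-- The morphism out of the bicomplex of a diagram determined by the images of the generators. -/
def desc (t : ∀ s : ℤ × ℤ, {g // D.deg g = s} → A.comp s.1 s.2)
    (h0 : ∀ s g, A.d0 s.1 s.2 (s.2 + 1) (t s g) = D.val t (s.1, s.2 + 1) (D.d0 g.1))
    (h1 : ∀ s g, A.d1 s.1 (s.1 - 1) s.2 (t s g) = D.val t (s.1 - 1, s.2) (D.d1 g.1)) :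
    D.toBicomplex R ⟶ A :=
  HomologicalComplex₂.homMk (fun s => ModuleCat.ofHom (Finsupp.linearCombination R (t s)))
    (fun i i' j hi => by
      obtain rfl : i' = i - 1 := by
        have : i' + 1 = i := hi
        lia
      change ModuleCat.ofHom (Finsupp.linearCombination R (t (i, j))) ≫
          ModuleCat.ofHom (A.d1 i (i - 1) j) = ModuleCat.ofHom (lin R D.d1 (i, j) (i - 1, j)) ≫
          ModuleCat.ofHom (Finsupp.linearCombination R (t (i - 1, j)))
      rw [← ModuleCat.ofHom_comp, ← ModuleCat.ofHom_comp]
      congr 1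
      refine Finsupp.lhom_ext' fun g => LinearMap.ext_ring ?_
      simp only [LinearMap.comp_apply, Finsupp.lsingle_apply]
      rw [lin_single, linearCombination_vec]
      simpa using h1 (i, j) g)
    (fun i j j' hj => by
      obtain rfl : j + 1 = j' := hj
      change ModuleCat.ofHom (Finsupp.linearCombination R (t (i, j))) ≫
          ModuleCat.ofHom (A.d0 i j (j + 1)) = ModuleCat.ofHom (lin R D.d0 (i, j) (i, j + 1)) ≫
          ModuleCat.ofHom (Finsupp.linearCombination R (t (i, j + 1)))
      rw [← ModuleCat.ofHom_comp, ← ModuleCat.ofHom_comp]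
      congr 1
      refine Finsupp.lhom_ext' fun g => LinearMap.ext_ring ?_
      simp only [LinearMap.comp_apply, Finsupp.lsingle_apply]
      rw [lin_single, linearCombination_vec]
      simpa using h0 (i, j) g)

variable (R) in
/-- The basis vector of a generator, as an element of the bicomplex of the diagram. -/
def elt (i j : ℤ) (o : Option D.Gen) : (D.toBicomplex R).comp i j := D.vec R (i, j) o

lemma app_desc_elt (t : ∀ s : ℤ × ℤ, {g // D.deg g = s} → A.comp s.1 s.2) (h0 h1)
    (i j : ℤ) (o : Option D.Gen) :
    Bicomplex.app (D.desc t h0 h1) i j (D.elt R i j o) = D.val t (i, j) o :=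
  D.linearCombination_vec t (i, j) o

lemma hom_ext {f g : D.toBicomplex R ⟶ A}
    (h : ∀ x, Bicomplex.app f _ _ (D.elt R (D.deg x).1 (D.deg x).2 (some x)) =
      Bicomplex.app g _ _ (D.elt R (D.deg x).1 (D.deg x).2 (some x))) : f = g := by
  ext i j : 3
  refine Finsupp.lhom_ext' fun x => LinearMap.ext_ring ?_
  obtain ⟨x, hx⟩ := x
  obtain rfl : i = (D.deg x).1 := by rw [hx]
  obtain rfl : j = (D.deg x).2 := by rw [hx]
  have := h x
  rw [elt, vec, dif_pos rfl] at this
  exact this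

/-- A basis vector read in a foreign bidegree is zero. The condition `j + 1 = j'` makes both sides
vanish together: a generator outside bidegree (i, j) has its image outside (i, j'). -/
lemma d0_elt (i j j' : ℤ) (o : Option D.Gen) (h : j + 1 = j') :
    (D.toBicomplex R).d0 i j j' (D.elt R i j o) = D.elt R i j' (o.bind D.d0) := by
  refine lin_vec D.d0 _ _ o fun g _ hne g' hg' he => hne ?_
  rw [D.deg_d0 g g' hg', Prod.mk.injEq] at he
  exact Prod.ext he.1 (by simpa [← h] using he.2)

lemma d1_elt (i i' j : ℤ) (o : Option D.Gen) (h : i' + 1 = i) :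
    (D.toBicomplex R).d1 i i' j (D.elt R i j o) = D.elt R i' j (o.bind D.d1) := by
  refine lin_vec D.d1 _ _ o fun g _ hne g' hg' he => hne ?_
  rw [D.deg_d1 g g' hg', Prod.mk.injEq] at he
  exact Prod.ext (by simp only; lia) he.2

lemma app_toBicomplexMap_elt {D D' : BicomplexDiagram} (F : D.Gen → Option D'.Gen)
    (deg_F : ∀ g, ∀ h ∈ F g, D'.deg h = D.deg g)
    (F_d0 : ∀ g, (F g).bind D'.d0 = (D.d0 g).bind F)
    (F_d1 : ∀ g, (F g).bind D'.d1 = (D.d1 g).bind F) (i j : ℤ) (o : Option D.Gen) :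
    Bicomplex.app (toBicomplexMap R F deg_F F_d0 F_d1) i j (D.elt R i j o) =
      D'.elt R i j (o.bind F) :=
  lin_vec F _ _ o fun g _ hne g' hg' he => hne ((deg_F g g' hg').symm.trans he)

end BicomplexDiagram

/-! ### Representability of witness cycles and boundaries, and lifting properties -/

namespace Bicomplex

variable {R : Type u} [CommRing R]

@[simp] lemma app_comp {A B C : Bicomplex R} (f : A ⟶ B) (g : B ⟶ C) (i j : ℤ) (x : A.comp i j) :
    app (f ≫ g) i j x = app g i j (app f i j x) := rfl

lemma ZW_ext {A : Bicomplex R} {r : ℕ} {p q : ℤ} {x y : A.ZW (r + 1) p q}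
    (h : ∀ k, x.1 k = y.1 k) : x = y :=
  Subtype.ext (funext h)

lemma ZWMap_id (A : Bicomplex R) (r : ℕ) (p q : ℤ) (x : A.ZW r p q) : ZWMap (𝟙 A) r p q x = x := by
  cases r <;> rfl

lemma ZWMap_comp {A B C : Bicomplex R} (f : A ⟶ B) (g : B ⟶ C) (r : ℕ) (p q : ℤ)
    (x : A.ZW r p q) : ZWMap (f ≫ g) r p q x = ZWMap g r p q (ZWMap f r p q x) := by
  cases r <;> rfl

lemma BWMap_comp {A B C : Bicomplex R} (f : A ⟶ B) (g : B ⟶ C) (r : ℕ) (p q : ℤ)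
    (x : A.BW r p q) : BWMap (f ≫ g) r p q x = BWMap g r p q (BWMap f r p q x) := by
  match r with
  | 0 => rfl
  | 1 => rfl
  | r + 2 => rfl

/-- The tautological `r`-witness cycle of `𝒵𝒲_r(p, q)`. -/
def univZW : (r : ℕ) → (p q : ℤ) → (repZW R r p q).ZW r p q
  | 0, p, q => (squareDiagram p q).elt R p q (some SquareGen.x)
  | r + 1, p, q => ⟨fun k => (stairDiagram r p q).elt R (p - (k : ℕ)) (q - (k : ℕ))
        (some (StairGen.a k)),
      BicomplexDiagram.d0_elt (stairDiagram r p q) _ _ _ (some (StairGen.a 0)) (by simp), fun k =>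
      (BicomplexDiagram.d0_elt (stairDiagram r p q) _ _ _ (some (StairGen.a k.succ))
        (by simp; lia)).trans
      (BicomplexDiagram.d1_elt (stairDiagram r p q) _ _ _ (some (StairGen.a k.castSucc))
        (by simp; lia)).symm⟩

/-- The images of the generators under the morphism that represents an element of `A`. -/
def squareVal {A : Bicomplex R} {p q : ℤ} (z : A.comp p q) (s : ℤ × ℤ) :
    {g // (squareDiagram p q).deg g = s} → A.comp s.1 s.2
  | ⟨.x, h⟩ => A.transport congr(($h).1) congr(($h).2) z
  | ⟨.d0x, h⟩ => A.transport congr(($h).1) congr(($h).2) (A.d0 p q (q + 1) z)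
  | ⟨.d1x, h⟩ => A.transport congr(($h).1) congr(($h).2) (A.d1 p (p - 1) q z)
  | ⟨.d0d1x, h⟩ => A.transport congr(($h).1) congr(($h).2)
      (A.d0 (p - 1) q (q + 1) (A.d1 p (p - 1) q z))

/-- The images of the generators under the morphism that represents a witness cycle of `A`. -/
def stairVal {A : Bicomplex R} {r : ℕ} {p q : ℤ} (z : A.ZW (r + 1) p q) (s : ℤ × ℤ) :
    {g // (stairDiagram r p q).deg g = s} → A.comp s.1 s.2
  | ⟨.a k, h⟩ => A.transport congr(($h).1) congr(($h).2) (z.1 k)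
  | ⟨.b k, h⟩ => A.transport congr(($h).1) congr(($h).2)
      (A.d1 (p - (k : ℕ)) (p - (k : ℕ) - 1) (q - (k : ℕ)) (z.1 k))

lemma d0_eq_transport (A : Bicomplex R) (i : ℤ) {j k k' : ℤ} (hk : k = k') (x : A.comp i j) :
    A.d0 i j k' x = A.transport rfl hk (A.d0 i j k x) := by
  subst hk; rfl

lemma d1_eq_transport (A : Bicomplex R) {i k k' : ℤ} (j : ℤ) (hk : k = k') (x : A.comp i j) :
    A.d1 i k' j x = A.transport hk rfl (A.d1 i k j x) := by
  subst hk; rfl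

/-- For k > 0 one has d₀d₁a_k = d₁d₀a_k = d₁d₁a_{k-1} = 0, and for k = 0 already d₀a₀ = 0. This is
the relation d₀b_k = 0 needed to map a staircase to A. -/
lemma d0_d1_witness {A : Bicomplex R} {r : ℕ} {p q : ℤ} (z : A.witnessTuples r p q)
    (k : Fin (r + 1)) (i' : ℤ) :
    A.d0 i' (q - (k : ℕ)) (q - (k : ℕ) + 1) (A.d1 (p - (k : ℕ)) i' (q - (k : ℕ)) (z.1 k)) = 0 := by
  rw [d0_d1]
  induction k using Fin.cases with
  | zero =>
    rw [A.d0_eq_transport _ (by simp : q + 1 = _), z.2.1, map_zero, map_zero]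
  | succ k =>
    rw [A.d0_eq_transport _ (by simp; lia : q - (k.castSucc : ℕ) = _), z.2.2,
      A.d1_transport rfl _ rfl, d1_d1, map_zero]

/-- The morphism `𝒵𝒲_r(p, q) ⟶ A` that corresponds to a witness cycle. -/
def ofZW {A : Bicomplex R} : (r : ℕ) → (p q : ℤ) → A.ZW r p q → (repZW R r p q ⟶ A)
  | 0, p, q, z => (squareDiagram p q).desc (squareVal (A := A) z)
      (by
        rintro _ ⟨_ | _ | _ | _, rfl⟩
        · exact ((squareDiagram p q).val_some (squareVal (A := A) z) (g := SquareGen.d0x) rfl).symm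
        · exact A.d0_d0 _ _ _ _ _
        · exact ((squareDiagram p q).val_some (squareVal (A := A) z)
            (g := SquareGen.d0d1x) rfl).symm
        · exact A.d0_d0 _ _ _ _ _)
      (by
        rintro _ ⟨_ | _ | _ | _, rfl⟩
        · exact ((squareDiagram p q).val_some (squareVal (A := A) z) (g := SquareGen.d1x) rfl).symm
        · exact (A.d0_d1 _ _ _ _ _).symm.trans
            ((squareDiagram p q).val_some (squareVal (A := A) z) (g := SquareGen.d0d1x) rfl).symm
        · exact A.d1_d1 _ _ _ _ _
        · exact (A.d0_d1 (p - 1) _ q (q + 1) _).symm.trans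
            ((congrArg _ (A.d1_d1 _ _ _ _ _)).trans (map_zero _)))
  | r + 1, p, q, z => (stairDiagram r p q).desc (stairVal z)
      (by
        rintro _ ⟨⟨_ | k, hk⟩ | k, rfl⟩
        · exact (A.d0_eq_transport _ (by simp [stairDiagram] : q + 1 = _) _).trans
            ((congrArg _ z.2.1).trans (map_zero (A.transport _ _)))
        · have h : (p - ((⟨k, by lia⟩ : Fin (r + 1)) : ℕ) - 1,
            q - ((⟨k, by lia⟩ : Fin (r + 1)) : ℕ))
              = (p - ((k + 1 : ℕ) : ℤ), q - ((k + 1 : ℕ) : ℤ) + 1) := by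
            ext <;> simp <;> lia
          refine Eq.trans ?_ ((stairDiagram r p q).val_some (stairVal z)
            (g := StairGen.b ⟨k, by lia⟩) h).symm
          refine (A.d0_eq_transport _ congr(($h).2) _).trans
            ((congrArg (A.transport _ _) ((z.2.2 ⟨k, by lia⟩).trans
              (A.d1_eq_transport _ congr(($h).1) _))).trans ?_)
          exact A.transport_transport _ _ _ _ _
        · exact d0_d1_witness z k _)
      (by
        rintro _ ⟨k | k, rfl⟩
        · exact ((stairDiagram r p q).val_some (stairVal z) (g := StairGen.b k) rfl).symm
        · exact A.d1_d1 _ _ _ _ _)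

/-- Existence half of representability; `repZW_hom_ext` is the uniqueness half. -/
lemma ZWMap_ofZW {A : Bicomplex R} (r : ℕ) (p q : ℤ) (z : A.ZW r p q) :
    ZWMap (ofZW r p q z) r p q (univZW r p q) = z := by
  cases r with
  | zero =>
    exact ((squareDiagram p q).linearCombination_vec _ _ _).trans
      ((squareDiagram p q).val_some (squareVal (A := A) z) (g := SquareGen.x) rfl)
  | succ r =>
    refine ZW_ext fun k => ?_
    exact ((stairDiagram r p q).linearCombination_vec _ _ _).trans
      ((stairDiagram r p q).val_some (stairVal z) (g := StairGen.a k) rfl)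

lemma app_d0_elt_congr {D : BicomplexDiagram} {A : Bicomplex R} {f g : D.toBicomplex R ⟶ A}
    {i j : ℤ} {o : Option D.Gen} (j' : ℤ) (hj : j + 1 = j')
    (e : app f i j (D.elt R i j o) = app g i j (D.elt R i j o)) :
    app f i j' (D.elt R i j' (o.bind D.d0)) = app g i j' (D.elt R i j' (o.bind D.d0)) := by
  rw [← D.d0_elt i j j' o hj, app_d0, app_d0, e]

lemma app_d1_elt_congr {D : BicomplexDiagram} {A : Bicomplex R} {f g : D.toBicomplex R ⟶ A}
    {i j : ℤ} {o : Option D.Gen} (i' : ℤ) (hi : i' + 1 = i)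
    (e : app f i j (D.elt R i j o) = app g i j (D.elt R i j o)) :
    app f i' j (D.elt R i' j (o.bind D.d1)) = app g i' j (D.elt R i' j (o.bind D.d1)) := by
  rw [← D.d1_elt i i' j o hi, app_d1, app_d1, e]

/-- The entries of the universal cycle generate under d₀ and d₁: the square is generated by x, and
b_k = d₁a_k in the staircase. Agreement of two morphisms propagates along differentials. -/
lemma repZW_hom_ext {A : Bicomplex R} {r : ℕ} {p q : ℤ} {f g : repZW R r p q ⟶ A}
    (h : ZWMap f r p q (univZW r p q) = ZWMap g r p q (univZW r p q)) : f = g := by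
  cases r with
  | zero =>
    have hx : app f p q ((squareDiagram p q).elt R p q (some SquareGen.x)) =
      app g p q ((squareDiagram p q).elt R p q (some SquareGen.x)) := h
    refine (squareDiagram p q).hom_ext ?_
    rintro (_ | _ | _ | _)
    · exact hx
    · exact app_d0_elt_congr _ rfl hx
    · exact app_d1_elt_congr _ (sub_add_cancel _ _) hx
    · exact app_d0_elt_congr _ rfl (app_d1_elt_congr (p - 1) (sub_add_cancel _ _) hx)
  | succ r =>
    refine (stairDiagram r p q).hom_ext ?_
    rintro (k | k)
    · exact congr(($h).1 k)
    · have hk : app f (p - (k : ℕ)) (q - (k : ℕ)) ((stairDiagram r p q).elt R (p - (k : ℕ))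
          (q - (k : ℕ)) (some (StairGen.a k))) = app g (p - (k : ℕ)) (q - (k : ℕ))
          ((stairDiagram r p q).elt R (p - (k : ℕ)) (q - (k : ℕ)) (some (StairGen.a k))) :=
        congr(($h).1 k)
      exact app_d1_elt_congr _ (sub_add_cancel _ _) hk

/-- The inclusion of the first summand of `ℬ𝒲_{r+2}(p, q)`. -/
def bwUpper (r : ℕ) (p q : ℤ) :
    repZW R (r + 1) (p + (r + 1 : ℕ)) (q + (r + 1 : ℕ)) ⟶ repBW R (r + 2) p q :=
  biprod.inl

/-- The inclusion of the second summand of `ℬ𝒲_{r+2}(p, q)`. -/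
def bwMiddle (r : ℕ) (p q : ℤ) : repZW R 0 p q ⟶ repBW R (r + 2) p q :=
  biprod.inl ≫ biprod.inr (X := repZW R (r + 1) (p + (r + 1 : ℕ)) (q + (r + 1 : ℕ)))

/-- The inclusion of the third summand of `ℬ𝒲_{r+2}(p, q)`. -/
def bwLower (r : ℕ) (p q : ℤ) : repZW R (r + 1) (p - 1) q ⟶ repBW R (r + 2) p q :=
  biprod.inr ≫ biprod.inr (X := repZW R (r + 1) (p + (r + 1 : ℕ)) (q + (r + 1 : ℕ)))

/-- The morphism out of `ℬ𝒲_{r+2}(p, q)` determined by its restrictions to the summands. -/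
def bwDesc {A : Bicomplex R} {r : ℕ} {p q : ℤ}
    (f : repZW R (r + 1) (p + (r + 1 : ℕ)) (q + (r + 1 : ℕ)) ⟶ A) (g : repZW R 0 p q ⟶ A)
    (h : repZW R (r + 1) (p - 1) q ⟶ A) : repBW R (r + 2) p q ⟶ A :=
  biprod.desc f (biprod.desc g h)

section

variable {A : Bicomplex R} {r : ℕ} {p q : ℤ}
    (f : repZW R (r + 1) (p + (r + 1 : ℕ)) (q + (r + 1 : ℕ)) ⟶ A) (g : repZW R 0 p q ⟶ A)
    (h : repZW R (r + 1) (p - 1) q ⟶ A)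

lemma bwUpper_desc : bwUpper r p q ≫ bwDesc f g h = f :=
  biprod.inl_desc _ _

lemma bwMiddle_desc : bwMiddle r p q ≫ bwDesc f g h = g :=
  (Category.assoc _ _ _).trans
    ((congrArg _ (biprod.inr_desc f (biprod.desc g h))).trans (biprod.inl_desc _ _))

lemma bwLower_desc : bwLower r p q ≫ bwDesc f g h = h :=
  (Category.assoc _ _ _).trans
    ((congrArg _ (biprod.inr_desc f (biprod.desc g h))).trans (biprod.inr_desc _ _))

lemma bw_hom_ext {f g : repBW R (r + 2) p q ⟶ A} (h₁ : bwUpper r p q ≫ f = bwUpper r p q ≫ g)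
    (h₂ : bwMiddle r p q ≫ f = bwMiddle r p q ≫ g) (h₃ : bwLower r p q ≫ f = bwLower r p q ≫ g) :
    f = g :=
  biprod.hom_ext' _ _ h₁ (biprod.hom_ext' _ _
    ((Category.assoc _ _ _).symm.trans (h₂.trans (Category.assoc _ _ _)))
    ((Category.assoc _ _ _).symm.trans (h₃.trans (Category.assoc _ _ _))))

end

/-- The tautological `r`-witness boundary of `ℬ𝒲_r(p, q)`. -/
def univBW : (r : ℕ) → (p q : ℤ) → (repBW R r p q).BW r p q
  | 0, _, _ => PUnit.unit
  | 1, p, q => univZW 0 p q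
  | r + 2, p, q =>
    (ZWMap (bwUpper r p q) _ _ _ (univZW (r + 1) (p + (r + 1 : ℕ)) (q + (r + 1 : ℕ))),
      ZWMap (bwMiddle r p q) 0 _ _ (univZW 0 p q),
      ZWMap (bwLower r p q) _ _ _ (univZW (r + 1) (p - 1) q))

lemma exists_ofBW {A : Bicomplex R} (r : ℕ) (p q : ℤ) (x : A.BW r p q) :
    ∃ g : repBW R r p q ⟶ A, BWMap g r p q (univBW r p q) = x := by
  match r with
  | 0 => exact ⟨0, rfl⟩
  | 1 => exact ⟨ofZW 0 p q x, ZWMap_ofZW 0 p q x⟩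
  | r + 2 =>
    let f := ofZW _ _ _ x.1
    let g := ofZW 0 p q x.2.1
    let h := ofZW _ _ _ x.2.2
    refine ⟨bwDesc f g h, Prod.ext ?_ (Prod.ext ?_ ?_)⟩
    · refine (ZWMap_comp (bwUpper r p q) (bwDesc f g h) (r + 1) _ _ _).symm.trans ?_
      rw [bwUpper_desc]
      exact ZWMap_ofZW _ _ _ _
    · refine (ZWMap_comp (bwMiddle r p q) (bwDesc f g h) 0 _ _ _).symm.trans ?_
      rw [bwMiddle_desc]
      exact ZWMap_ofZW 0 _ _ _
    · refine (ZWMap_comp (bwLower r p q) (bwDesc f g h) (r + 1) _ _ _).symm.trans ?_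
      rw [bwLower_desc]
      exact ZWMap_ofZW _ _ _ _

lemma repBW_hom_ext {A : Bicomplex R} {r : ℕ} {p q : ℤ} {f g : repBW R r p q ⟶ A}
    (h : BWMap f r p q (univBW r p q) = BWMap g r p q (univBW r p q)) : f = g := by
  match r with
  | 0 => exact (isZero_zero _).eq_of_src _ _
  | 1 => exact repZW_hom_ext (r := 0) h
  | r + 2 =>
    refine bw_hom_ext (repZW_hom_ext ?_) (repZW_hom_ext ?_) (repZW_hom_ext ?_)
    · rw [ZWMap_comp, ZWMap_comp]
      exact congr(($h).1)
    · rw [ZWMap_comp, ZWMap_comp]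
      exact congr(($h).2.1)
    · rw [ZWMap_comp, ZWMap_comp]
      exact congr(($h).2.2)

lemma app_add {A B : Bicomplex R} (f g : A ⟶ B) (i j : ℤ) (x : A.comp i j) :
    app (f + g) i j x = app f i j x + app g i j x := rfl

lemma phi_eq (r : ℕ) (p : ℤ) {q q' : ℤ} (h : q + 1 = q') :
    phi R (r + 2) p h = stairToUpper R r p h ≫ bwUpper r p q +
      (stairToSquare R (r + 1) p h ≫ bwMiddle r p q + stairToLower R r p h ≫ bwLower r p q) := by
  refine (biprod.lift_eq (f := stairToUpper R r p h)
    (g := biprod.lift (stairToSquare R (r + 1) p h) (stairToLower R r p h))).trans ?_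
  rw [biprod.lift_eq (f := stairToSquare R (r + 1) p h) (g := stairToLower R r p h),
    Preadditive.add_comp, Category.assoc, Category.assoc]
  rfl

lemma app_phi {r : ℕ} {p : ℤ} {q q' : ℤ} (h : q + 1 = q') (i j : ℤ)
    (x : (repZW R (r + 2) p q').comp i j) :
    app (phi R (r + 2) p h) i j x = app (bwUpper r p q) i j (app (stairToUpper R r p h) i j x) +
      (app (bwMiddle r p q) i j (app (stairToSquare R (r + 1) p h) i j x) +
        app (bwLower r p q) i j (app (stairToLower R r p h) i j x)) := by
  rw [phi_eq]
  rfl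

/-- Basis vectors make sense in every bidegree, so a transport is absorbed into the indices of
`elt`. This and the two analogues below remove all transports from the comparison of w with φ. -/
lemma transport_app_d0 {D : BicomplexDiagram} {A : Bicomplex R} (f : D.toBicomplex R ⟶ A)
    (o : Option D.Gen) {i i' j k k' : ℤ} (hi : i = i') (hk : k = k') (h : j + 1 = k) :
    A.transport hi hk (A.d0 i j k (app f i j (D.elt R i j o))) =
      app f i' k' (D.elt R i' k' (o.bind D.d0)) := by
  subst hi hk
  rw [transport_rfl, ← app_d0, D.d0_elt _ _ _ _ h]

lemma transport_app_d1 {D : BicomplexDiagram} {A : Bicomplex R} (f : D.toBicomplex R ⟶ A)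
    (o : Option D.Gen) {i j j' k k' : ℤ} (hj : j = j') (hk : k = k') (h : k + 1 = i) :
    A.transport hk hj (A.d1 i k j (app f i j (D.elt R i j o))) =
      app f k' j' (D.elt R k' j' (o.bind D.d1)) := by
  subst hj hk
  rw [transport_rfl, ← app_d1, D.d1_elt _ _ _ _ h]

lemma transport_app {D : BicomplexDiagram} {A : Bicomplex R} (f : D.toBicomplex R ⟶ A)
    (o : Option D.Gen) {i i' j j' : ℤ} (hi : i = i') (hj : j = j') :
    A.transport hi hj (app f i j (D.elt R i j o)) = app f i' j' (D.elt R i' j' o) := by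
  subst hi hj; rfl

lemma app_elt_none {D : BicomplexDiagram} {A : Bicomplex R} (f : D.toBicomplex R ⟶ A) (i j : ℤ) :
    app f i j (D.elt R i j none) = 0 :=
  map_zero _

section

variable (r : ℕ) (p : ℤ) {q q' : ℤ} (h : q + 1 = q')

lemma app_stairToUpper_zero (i j : ℤ) {h0} :
    app (stairToUpper R r p h) i j ((stairDiagram (r + 1) p q').elt R i j
        (some (StairGen.a ⟨0, h0⟩))) =
      (stairDiagram r (p + (r + 1 : ℕ)) (q + (r + 1 : ℕ))).elt R i j
          (some (StairGen.b (Fin.last r))) :=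
  BicomplexDiagram.app_toBicomplexMap_elt _ _ _ _ _ _ _

lemma app_stairToUpper_succ (i j : ℤ) {k : ℕ} {hk} :
    app (stairToUpper R r p h) i j ((stairDiagram (r + 1) p q').elt R i j
        (some (StairGen.a ⟨k + 1, hk⟩))) =
      (stairDiagram r (p + (r + 1 : ℕ)) (q + (r + 1 : ℕ))).elt R i j none :=
  BicomplexDiagram.app_toBicomplexMap_elt _ _ _ _ _ _ _

lemma app_stairToSquare_zero (i j : ℤ) {h0} :
    app (stairToSquare R r p h) i j ((stairDiagram r p q').elt R i j (some (StairGen.a ⟨0, h0⟩))) =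
      (squareDiagram p q).elt R i j (some SquareGen.d0x) :=
  BicomplexDiagram.app_toBicomplexMap_elt _ _ _ _ _ _ _

lemma app_stairToSquare_one (i j : ℤ) {hk} :
    app (stairToSquare R r p h) i j ((stairDiagram r p q').elt R i j (some (StairGen.a ⟨1, hk⟩))) =
      (squareDiagram p q).elt R i j (some SquareGen.d1x) :=
  BicomplexDiagram.app_toBicomplexMap_elt _ _ _ _ _ _ _

lemma app_stairToSquare_add_two (i j : ℤ) {k : ℕ} {hk} :
    app (stairToSquare R r p h) i j ((stairDiagram r p q').elt R i j
        (some (StairGen.a ⟨k + 2, hk⟩))) =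
      (squareDiagram p q).elt R i j none :=
  BicomplexDiagram.app_toBicomplexMap_elt _ _ _ _ _ _ _

lemma app_stairToLower_zero (i j : ℤ) {h0} :
    app (stairToLower R r p h) i j ((stairDiagram (r + 1) p q').elt R i j
        (some (StairGen.a ⟨0, h0⟩))) =
      (stairDiagram r (p - 1) q).elt R i j none :=
  BicomplexDiagram.app_toBicomplexMap_elt _ _ _ _ _ _ _

lemma app_stairToLower_succ (i j : ℤ) {k : ℕ} {hk} :
    app (stairToLower R r p h) i j ((stairDiagram (r + 1) p q').elt R i j
        (some (StairGen.a ⟨k + 1, hk⟩))) =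
      (stairDiagram r (p - 1) q).elt R i j (some (StairGen.a ⟨k, by lia⟩)) :=
  BicomplexDiagram.app_toBicomplexMap_elt _ _ _ _ _ _ _

end

/-- This says that φ_r induces w_r: by naturality of w and representability, it suffices to compare
both on universal elements. -/
lemma wMap_univBW (r : ℕ) (p : ℤ) {q q' : ℤ} (h : q + 1 = q') :
    wMap _ r p h (univBW r p q) = ZWMap (phi R r p h) r p q' (univZW r p q') := by
  match r with
  | 0 => rfl
  | 1 =>
    refine ZW_ext (r := 0) fun k => ?_
    fin_cases k
    refine (transport_app_d0 (D := squareDiagram p q) (𝟙 _) (some SquareGen.x)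
      (by simp) (by simp) h).trans ?_
    exact (app_stairToSquare_zero 0 p h _ _).symm
  | r + 2 =>
    refine ZW_ext (r := r + 1) fun k => ?_
    refine Eq.trans ?_ (app_phi h _ _
      ((stairDiagram (r + 1) p q').elt R _ _ (some (StairGen.a k)))).symm
    match k with
    | ⟨0, _⟩ =>
      refine Eq.trans ?_ (add_assoc _ _ _)
      -- An entry of the w-tuple has fewer summands than the three components of φ. The missing ones
      -- are zeros, coming from the components that kill this generator; here `stairToLower` kills
      -- a₀.
      refine Eq.trans (add_zero _).symm (congrArg₂ _ (congrArg₂ _ ?_ ?_) ?_)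
      · refine (transport_app_d1 (D := stairDiagram r (p + (r + 1 : ℕ)) (q + (r + 1 : ℕ)))
          (bwUpper r p q) (some (StairGen.a (Fin.last r))) _ _ (by simp; lia)).trans ?_
        exact congrArg (app (bwUpper r p q) _ _) 
          (app_stairToUpper_zero r p h _ _).symm
      · refine (transport_app_d0 (D := squareDiagram p q)
          (bwMiddle r p q) (some SquareGen.x) _ _ h).trans ?_
        exact congrArg (app (bwMiddle r p q) _ _)
          (app_stairToSquare_zero (r + 1) p h _ _).symm
      · refine (app_elt_none (D := stairDiagram r (p - 1) q) (bwLower r p q) _ _).symm.trans ?_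
        exact congrArg (app (bwLower r p q) _ _)
          (app_stairToLower_zero r p h _ _).symm
    | ⟨1, _⟩ =>
      refine Eq.trans (zero_add _).symm (congrArg₂ _ ?_ (congrArg₂ _ ?_ ?_))
      · refine (app_elt_none (D := stairDiagram r (p + (r + 1 : ℕ)) (q + (r + 1 : ℕ)))
          (bwUpper r p q) _ _).symm.trans ?_
        exact congrArg (app (bwUpper r p q) _ _)
          (app_stairToUpper_succ r p h _ _).symm
      · refine (transport_app_d1 (D := squareDiagram p q)
          (bwMiddle r p q) (some SquareGen.x) _ _ (by simp)).trans ?_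
        exact congrArg (app (bwMiddle r p q) _ _)
          (app_stairToSquare_one (r + 1) p h _ _).symm
      · refine (transport_app (D := stairDiagram r (p - 1) q)
          (bwLower r p q) (some (StairGen.a 0)) _ _).trans ?_
        exact congrArg (app (bwLower r p q) _ _)
          (app_stairToLower_succ r p h _ _).symm
    | ⟨k + 2, hk⟩ =>
      refine Eq.trans (zero_add _).symm (congrArg₂ _ ?_
        (Eq.trans (zero_add _).symm (congrArg₂ _ ?_ ?_)))
      · refine (app_elt_none (D := stairDiagram r (p + (r + 1 : ℕ)) (q + (r + 1 : ℕ)))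
          (bwUpper r p q) _ _).symm.trans ?_
        exact congrArg (app (bwUpper r p q) _ _)
          (app_stairToUpper_succ r p h _ _).symm
      · refine (app_elt_none (D := squareDiagram p q) (bwMiddle r p q) _ _).symm.trans ?_
        exact congrArg (app (bwMiddle r p q) _ _)
          (app_stairToSquare_add_two (r + 1) p h _ _).symm
      · refine (transport_app (D := stairDiagram r (p - 1) q)
          (bwLower r p q) (some (StairGen.a ⟨k + 1, by lia⟩)) _ _).trans ?_
        exact congrArg (app (bwLower r p q) _ _)
          (app_stairToLower_succ r p h _ _).symm

lemma hasLiftingProperty_zero_iff {A B : Bicomplex R} (f : A ⟶ B) (r : ℕ) (p q : ℤ) :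
    HasLiftingProperty (0 : (0 : Bicomplex R) ⟶ repZW R r p q) f ↔
      Function.Surjective (ZWMap f r p q) := by
  refine ⟨fun _ z => ?_, fun hf => ⟨fun {u v} sq => ?_⟩⟩
  · have sq : CommSq (0 : 0 ⟶ A) (0 : (0 : Bicomplex R) ⟶ repZW R r p q) f (ofZW r p q z) :=
      ⟨(isZero_zero _).eq_of_src _ _⟩
    refine ⟨ZWMap sq.lift r p q (univZW r p q), ?_⟩
    rw [← ZWMap_comp, sq.fac_right, ZWMap_ofZW]
  · obtain ⟨z, hz⟩ := hf (ZWMap v r p q (univZW r p q))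
    exact ⟨⟨{
      l := ofZW r p q z
      fac_left := (isZero_zero _).eq_of_src _ _
      fac_right := repZW_hom_ext (by rw [ZWMap_comp, ZWMap_ofZW, hz]) }⟩⟩

/-- A commutative square from φ to f is a pair (z, y) with f z = w y, by representability of its two
corners, and a lift is an x over both. -/
lemma hasLiftingProperty_phi_iff {A B : Bicomplex R} (f : A ⟶ B) (r : ℕ) (p : ℤ) {q q' : ℤ}
    (h : q + 1 = q') :
    HasLiftingProperty (phi R r p h) f ↔ ∀ (z : A.ZW r p q') (y : B.BW r p q),
      ZWMap f r p q' z = B.wMap r p h y → ∃ x, A.wMap r p h x = z ∧ BWMap f r p q x = y := by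
  refine ⟨fun _ z y hzy => ?_, fun hf => ⟨fun {u v} sq => ?_⟩⟩
  · obtain ⟨g, hg⟩ := exists_ofBW r p q y
    have sq : CommSq (ofZW r p q' z) (phi R r p h) f g := ⟨repZW_hom_ext (by
      rw [ZWMap_comp, ZWMap_comp, ZWMap_ofZW, ← wMap_univBW, ZWMap_wMap, hg, hzy])⟩
    refine ⟨BWMap sq.lift r p q (univBW r p q), ?_, ?_⟩
    · rw [← ZWMap_wMap, wMap_univBW, ← ZWMap_comp, sq.fac_left, ZWMap_ofZW]
    · rw [← BWMap_comp, sq.fac_right, hg]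
  · obtain ⟨x, hx, hx'⟩ := hf (ZWMap u r p q' (univZW r p q')) (BWMap v r p q (univBW r p q)) (by
      rw [← ZWMap_wMap, wMap_univBW, ← ZWMap_comp, ← ZWMap_comp, sq.w])
    obtain ⟨g, rfl⟩ := exists_ofBW r p q x
    exact ⟨⟨{
      l := g
      fac_left := repZW_hom_ext (by rw [ZWMap_comp, ← wMap_univBW, ZWMap_wMap, hx])
      fac_right := repBW_hom_ext (by rw [BWMap_comp, hx']) }⟩⟩

/-! ### The kernel of w and the comparison of I_r with the pages -/

lemma transport_injective (A : Bicomplex R) {i i' j j' : ℤ} (hi : i = i') (hj : j = j') :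
    Function.Injective (A.transport hi hj) := by
  subst hi hj
  exact fun _ _ h => h

/-- An equation between x and y read in one common bidegree may be read in any other name of that
bidegree. -/
lemma transport_eq_neg_of_add_eq_zero (A : Bicomplex R) {i j i' j' k l k' l' : ℤ}
    (hi : i = k) (hj : j = l) (hi' : i' = k) (hj' : j' = l) (hk : i = k') (hl : j = l')
    (hk' : i' = k') (hl' : j' = l') {x : A.comp i j} {y : A.comp i' j'}
    (h : A.transport hi hj x + A.transport hi' hj' y = 0) :
    A.transport hk hl x = -A.transport hk' hl' y := by
  subst hi hj hi' hj' hk hl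
  exact eq_neg_of_add_eq_zero_left h

lemma transport_eq_zero_iff (A : Bicomplex R) {i i' j j' : ℤ} (hi : i = i') (hj : j = j')
    (x : A.comp i j) : A.transport hi hj x = 0 ↔ x = 0 := by
  subst hi hj
  exact Iff.rfl

/-- The tuple `(x, 0, …, 0)`. -/
def singleTuple (A : Bicomplex R) (r : ℕ) (p q : ℤ) (x : A.comp p q) :
    (k : Fin (r + 1)) → A.comp (p - (k : ℕ)) (q - (k : ℕ))
  | ⟨0, _⟩ => A.transport (by simp) (by simp) x
  | ⟨_ + 1, _⟩ => 0

lemma singleTuple_mem (A : Bicomplex R) (r : ℕ) (p q : ℤ) (x : A.comp p q)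
    (h0 : A.d0 p q (q + 1) x = 0) (h1 : A.d1 p (p - 1) q x = 0) :
    A.singleTuple r p q x ∈ A.witnessTuples r p q := by
  refine ⟨?_, fun k => ?_⟩
  · refine (A.d0_transport _ _ rfl x).trans ?_
    rw [h0, map_zero]
  · match k with
    | ⟨0, hk⟩ =>
      have e : p - 1 = p - ((⟨0, hk⟩ : Fin r).succ : ℕ) := by simp
      refine (map_zero _).trans ((A.d1_transport _ _ e x).trans ?_).symm
      rw [h1, map_zero]
    | ⟨k + 1, hk⟩ => exact (map_zero _).trans (map_zero _).symm

/-- The boundary data `((b₀, …, b_r), -b_{r+1}, (d₁ b_{r+1}, 0, …, 0))` of a witness cycle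
`(b₀, …, b_{r+1})`. -/
def toKerAux (A : Bicomplex R) (r : ℕ) (p q : ℤ)
    (z : A.witnessTuples (r + 1) (p + (r + 1 : ℕ)) (q + (r + 1 : ℕ))) :
    A.witnessTuples r (p + (r + 1 : ℕ)) (q + (r + 1 : ℕ)) × A.comp p q ×
      A.witnessTuples r (p - 1) q :=
  (⟨fun k => z.1 k.castSucc, z.2.1, fun k => z.2.2 k.castSucc⟩,
    -A.transport (by simp) (by simp) (z.1 (Fin.last (r + 1))),
    ⟨A.singleTuple r (p - 1) q (A.d1 p (p - 1) q
        (A.transport (by simp) (by simp) (z.1 (Fin.last (r + 1))))),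
      -- The leading entry d₁b_{r+1} is killed by d₀ because it comes from a witness cycle, and by
      -- d₁ trivially.
      A.singleTuple_mem _ _ _ _ (by
        rw [A.d1_transport _ _ (rfl : p - 1 = _), A.d0_transport rfl _
          (by simp : q + (r + 1 : ℕ) - (Fin.last (r + 1) : ℕ) + 1 = _),
              d0_d1_witness, map_zero]) (A.d1_d1 _ _ _ _ _)⟩)

/-- The kernel of `w_{r+1}` consists of the witness cycles of length `r + 1`. -/
def toKer (A : Bicomplex R) : (r : ℕ) → (p q : ℤ) → A.ZW (r + 1) (p + r) (q + r) → A.BW (r + 1) p q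
  | 0, _, _, z => A.transport (by simp) (by simp) (z.1 0)
  | r + 1, p, q, z => A.toKerAux r p q z

lemma toKer_injective (A : Bicomplex R) (r : ℕ) (p q : ℤ) :
    Function.Injective (A.toKer r p q) := by
  intro z z' h
  cases r with
  | zero =>
    refine ZW_ext (r := 0) fun k => ?_
    fin_cases k
    exact A.transport_injective _ _ h
  | succ r =>
    refine ZW_ext (r := r + 1) fun k => ?_
    induction k using Fin.lastCases with
    | last => exact A.transport_injective _ _ (neg_injective congr(($h).2.1))
    | cast k => exact congr(($h).1.1 k)

lemma BWMap_toKer {A B : Bicomplex R} (f : A ⟶ B) (r : ℕ) (p q : ℤ)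
    (z : A.ZW (r + 1) (p + r) (q + r)) :
    BWMap f (r + 1) p q (A.toKer r p q z) = B.toKer r p q (ZWMap f (r + 1) _ _ z) := by
  cases r with
  | zero => exact app_transport f _ _ _
  | succ r =>
    refine Prod.ext rfl (Prod.ext ?_ (Subtype.ext (funext fun k => ?_)))
    · exact (map_neg (app f p q) _).trans (congrArg _ (app_transport f _ _ _))
    · match k with
      | ⟨0, _⟩ =>
        refine (app_transport f _ _ _).trans (congrArg _ ?_)
        exact (app_d1 f _ _ _ _).trans (congrArg _ (app_transport f _ _ _))
      | ⟨k + 1, _⟩ => exact map_zero (app f _ _)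

/-- In length at least two, position 0 is d₁b_r − d₀b_{r+1} = 0 by the last cycle relation, position
1 is −d₁b_{r+1} + d₁b_{r+1}, and the rest is zero. In length one the claim is d₀z₀ = 0. -/
lemma wMap_toKer (A : Bicomplex R) (r : ℕ) (p : ℤ) {q q' : ℤ} (h : q + 1 = q')
    (z : A.ZW (r + 1) (p + r) (q + r)) : A.wMap (r + 1) p h (A.toKer r p q z) = 0 := by
  cases r with
  | zero =>
    refine ZW_ext (r := 0) fun k => ?_
    fin_cases k
    have hz : A.d0 (p + (0 : ℕ) - (0 : ℕ)) (q + (0 : ℕ) - (0 : ℕ)) (q + (0 : ℕ) + 1) (z.1 0) = 0 :=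
      z.2.1
    change A.transport _ _ (A.d0 p q q' (A.transport _ _ (z.1 0))) = 0
    rw [A.d0_transport _ _ (by simpa using h : q + (0 : ℕ) + 1 = q'), transport_transport]
    exact (congrArg _ hz).trans (map_zero (A.transport _ _))
  | succ r =>
    refine ZW_ext (r := r + 1) fun k => ?_
    change A.wTuple r p h (A.toKerAux r p q z).1.1 (A.toKerAux r p q z).2.1
      (A.toKerAux r p q z).2.2.1 k = 0
    match k with
    | ⟨0, _⟩ =>
      refine (congrArg₂ _ ((congrArg _ (A.d1_eq_transport _
        (by simp : p + (r + 1 : ℕ) - ((Fin.last r).succ : ℕ) = p) _)).trans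
        ((A.transport_transport _ _ _ _ _).trans (congrArg _ (z.2.2 (Fin.last r)).symm)))
        ((congrArg _ ((map_neg (A.d0 p q q') _).trans (congrArg _ (A.d0_transport _ _
          (by simp; lia : q + (r + 1 : ℕ) - ((Fin.last r).castSucc : ℕ) = q') _)))).trans
          ((map_neg (A.transport _ _) _).trans
            (congrArg _ (A.transport_transport _ _ _ _ _))))).trans ?_
      exact add_neg_cancel _
    | ⟨1, _⟩ =>
      refine (congrArg₂ _ ((congrArg _ (map_neg (A.d1 p (p - 1) q) _)).trans
        (map_neg (A.transport _ _) _)) (A.transport_transport _ _ _ _ _)).trans ?_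
      exact neg_add_cancel _
    | ⟨k + 2, hk⟩ => exact map_zero (A.transport _ _)

/-- If w(b, a, c) = 0, then d₁b_r = −d₀a, so b prolonged by −a is a longer witness cycle. The other
positions force c₀ = −d₁a and c_k = 0 for k > 0, so c carries no further information. -/
lemma exists_toKer_eq (A : Bicomplex R) (r : ℕ) (p : ℤ) {q q' : ℤ} (h : q + 1 = q')
    (x : A.BW (r + 1) p q) (hx : A.wMap (r + 1) p h x = 0) : ∃ z, A.toKer r p q z = x := by
  cases r with
  | zero =>
    refine ⟨⟨fun k => A.transport (by simp) (by simp) x, ?_, fun k => k.elim0⟩, ?_⟩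
    · have h0 : A.d0 p q q' x = 0 :=
        (A.transport_eq_zero_iff (by simp) (by simp) _).1 congr(($hx).1 0)
      refine (A.d0_transport _ _ (by simp [h] : q' = _) _).trans ?_
      exact (congrArg _ h0).trans (map_zero (A.transport _ _))
    · exact A.transport_transport _ _ _ _ _
  | succ r =>
    obtain ⟨b, a, c⟩ : A.witnessTuples r (p + (r + 1 : ℕ)) (q + (r + 1 : ℕ)) × A.comp p q ×
      A.witnessTuples r (p - 1) q := x
    have hw : A.wTuple r p h b.1 a c.1 = 0 := congr(($hx).1)
    have h0 := congr($hw ⟨0, by lia⟩)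
    have h1 := congr($hw ⟨1, by lia⟩)
    let z : (k : Fin (r + 2)) → A.comp (p + (r + 1 : ℕ) - (k : ℕ)) (q + (r + 1 : ℕ) - (k : ℕ)) :=
      Fin.snoc (α := fun k : Fin (r + 2) =>
        A.comp (p + (r + 1 : ℕ) - (k : ℕ)) (q + (r + 1 : ℕ) - (k : ℕ))) b.1
        (A.transport (by simp) (by simp) (-a))
    have hz1 (k : Fin (r + 1)) : z k.castSucc = b.1 k := Fin.snoc_castSucc _ _ _
    have hz2 : z (Fin.last (r + 1)) = A.transport (by simp) (by simp) (-a) := Fin.snoc_last _ _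
    have hz : z ∈ A.witnessTuples (r + 1) (p + (r + 1 : ℕ)) (q + (r + 1 : ℕ)) := by
      refine ⟨(congrArg _ (hz1 0)).trans b.2.1, fun k => ?_⟩
      induction k using Fin.lastCases with
      | last =>
        refine (congrArg _ hz2).trans ((A.d0_transport _ _ (by simp; lia : q' = _) _).trans ?_)
        refine (congrArg _ (map_neg (A.d0 p q q') a)).trans ((map_neg (A.transport _ _) _).trans ?_)
        refine Eq.trans ?_ (congrArg _ (hz1 (Fin.last r))).symm
        -- Position 0 of w(b, a, c) = 0 is exactly the cycle relation missing for the appended entry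
        -- −a.
        refine (A.transport_eq_neg_of_add_eq_zero _ _ _ _ (by simp) rfl _ _ h0).symm.trans ?_
        exact (A.d1_eq_transport _ _ _).symm
      | cast k =>
        rw [hz1]
        exact (congrArg _ (hz1 k.succ)).trans (b.2.2 k)
    have ha : A.transport (by simp) (by simp) (z (Fin.last (r + 1))) = -a :=
      (congrArg _ hz2).trans (A.transport_transport _ _ _ _ _)
    refine ⟨⟨z, hz⟩, Prod.ext (Subtype.ext (funext hz1)) (Prod.ext ?_ (Subtype.ext
      (funext fun k => ?_)))⟩
    · exact (congrArg _ ha).trans (neg_neg a)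
    · match k with
      | ⟨0, _⟩ =>
        refine (congrArg (A.transport _ _) ((congrArg (A.d1 p (p - 1) q) ha).trans
          (map_neg (A.d1 p (p - 1) q) a))).trans ((map_neg (A.transport _ _) _).trans ?_)
        exact (congrArg _ (A.transport_eq_neg_of_add_eq_zero _ _ _ _ _ _ (by simp) (by simp)
          h1)).trans (neg_neg _)
      | ⟨k + 1, hk⟩ =>
        exact ((A.transport_eq_zero_iff _ _ _).1 congr($hw ⟨k + 2, by lia⟩)).symm

lemma page_injective_iff {A B : Bicomplex R} (f : A ⟶ B) (r : ℕ) (p q : ℤ) :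
    Function.Injective (pageMap f r p q) ↔ ∀ (z : A.ZW r p q) (y : B.BW r p (q - 1)),
      ZWMap f r p q z = B.wMap r p (sub_add_cancel q 1) y →
        ∃ x, A.wMap r p (sub_add_cancel q 1) x = z := by
  rw [injective_iff_map_eq_zero]
  refine ⟨fun h z y hzy => ?_, fun h z hz => ?_⟩
  · have := h (Submodule.Quotient.mk z) ((Submodule.Quotient.mk_eq_zero _).2 ⟨y, hzy.symm⟩)
    exact (Submodule.Quotient.mk_eq_zero (A.boundaries r p q)).1 this
  · obtain ⟨z, rfl⟩ := Submodule.Quotient.mk_surjective _ z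
    obtain ⟨y, hy⟩ := (Submodule.Quotient.mk_eq_zero (B.boundaries r p q)).1 hz
    exact (Submodule.Quotient.mk_eq_zero _).2 (h z y hy.symm)

lemma page_surjective_iff {A B : Bicomplex R} (f : A ⟶ B) (r : ℕ) (p q : ℤ) :
    Function.Surjective (pageMap f r p q) ↔ ∀ z' : B.ZW r p q, ∃ (z : A.ZW r p q)
      (y : B.BW r p (q - 1)), z' = ZWMap f r p q z + B.wMap r p (sub_add_cancel q 1) y := by
  refine ⟨fun h z' => ?_, fun h z' => ?_⟩
  · obtain ⟨z, hz⟩ := h (Submodule.Quotient.mk z')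
    obtain ⟨z, rfl⟩ := Submodule.Quotient.mk_surjective _ z
    obtain ⟨y, hy⟩ := (Submodule.Quotient.eq (B.boundaries r p q)).1 hz.symm
    exact ⟨z, y, by rw [hy]; abel⟩
  · obtain ⟨z', rfl⟩ := Submodule.Quotient.mk_surjective _ z'
    obtain ⟨z, y, rfl⟩ := h z'
    exact ⟨Submodule.Quotient.mk z, ((Submodule.Quotient.eq (B.boundaries r p q)).2
      ⟨y, by abel⟩).symm⟩

/-- BW_{r+1} is assembled from copies of ZW_0 and ZW_r only; this is where membership of both 0 and
r in S enters. -/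
lemma BWMap_surjective {A B : Bicomplex R} (f : A ⟶ B) (r : ℕ)
    (h0 : ∀ p q, Function.Surjective (ZWMap f 0 p q))
    (hr : ∀ p q, Function.Surjective (ZWMap f r p q)) (p q : ℤ) :
    Function.Surjective (BWMap f (r + 1) p q) := by
  cases r with
  | zero => exact h0 p q
  | succ r => exact (hr _ _).prodMap ((h0 _ _).prodMap (hr _ _))

/-- Among the morphisms which are surjective on `0`- and `r`-witness cycles, those with the right
lifting property with respect to `I_r` are the `r`-quasi-isomorphisms. -/
lemma setIr_rlp_iff_rQuasiIso {A B : Bicomplex R} (f : A ⟶ B) (r : ℕ)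
    (h0 : ∀ p q, Function.Surjective (ZWMap f 0 p q))
    (hr : ∀ p q, Function.Surjective (ZWMap f r p q)) :
    (setIr R r).rlp f ↔ rQuasiIso R r f := by
  have hI : (setIr R r).rlp f ↔ ∀ p q : ℤ,
      HasLiftingProperty (phi R (r + 1) p (sub_add_cancel q 1)) f :=
    ⟨fun h p q => h _ ⟨(p, q)⟩, by rintro h _ _ _ ⟨p, q⟩; exact h p q⟩
  simp only [hI, hasLiftingProperty_phi_iff]
  constructor
  · intro h p q
    refine ⟨(page_injective_iff _ _ _ _).2 fun z y hzy => ?_,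
      (page_surjective_iff _ _ _ _).2 fun z' => ?_⟩
    · obtain ⟨x, hx, -⟩ := h p q z y hzy
      exact ⟨x, hx⟩
    · suffices ∀ P Q (z' : B.ZW (r + 1) P Q), ∃ z, ZWMap f (r + 1) P Q z = z' by
        obtain ⟨z, hz⟩ := this p q z'
        exact ⟨z, 0, by rw [map_zero, add_zero, hz]⟩
      intro P Q z'
      -- The bidegree is shifted so that z' lies in the source of `toKer`.
      obtain ⟨P, rfl⟩ : ∃ P', P' + (r : ℤ) = P := ⟨P - r, by simp⟩
      obtain ⟨Q, rfl⟩ : ∃ Q', Q' - 1 + (r : ℤ) = Q := ⟨Q - r + 1, by simp⟩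
      -- A cycle z' of B gives a boundary datum killed by w. Lifting it over the zero cycle of A
      -- gives an element of the kernel of w over A, that is, a cycle mapping to z'.
      obtain ⟨x, hx, hx'⟩ := h P Q 0 (B.toKer r P (Q - 1) z') (by rw [map_zero, wMap_toKer])
      obtain ⟨z, rfl⟩ := A.exists_toKer_eq _ _ _ _ hx
      exact ⟨z, B.toKer_injective _ _ _ (by rw [← BWMap_toKer, hx'])⟩
  · intro h p q z y hzy
    have hs := BWMap_surjective f r h0 hr
    obtain ⟨x, hx⟩ := (page_injective_iff _ _ _ _).1 (h p q).1 z y hzy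
    -- The preimage x of z need not map to y, but the error lies in the kernel of w, hence is a
    -- cycle z' of B. Surjectivity on the page writes z' as f u + w v, and v lifts to A, so x can be
    -- corrected by `toKer` of a cycle of A without changing w x.
    have hker : B.wMap (r + 1) p (sub_add_cancel q 1) (y - BWMap f (r + 1) p (q - 1) x) = 0 := by
      rw [map_sub, ← ZWMap_wMap, hx, hzy, sub_self]
    obtain ⟨z', hz'⟩ := B.exists_toKer_eq _ _ _ _ hker
    obtain ⟨u, v, huv⟩ := (page_surjective_iff _ _ _ _).1 (h _ _).2 z'
    obtain ⟨v, rfl⟩ := hs _ _ v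
    rw [← ZWMap_wMap, ← map_add] at huv
    refine ⟨x + A.toKer r p (q - 1) (u + A.wMap (r + 1) _ (sub_add_cancel _ 1) v), ?_, ?_⟩
    · rw [map_add, wMap_toKer, hx, add_zero]
    · rw [map_add, BWMap_toKer, ← huv, hz']
      abel

end Bicomplex

/-! ### Bicomplexes with an ambient module -/

/-- A bicomplex whose components are submodules of a fixed module `V`, and whose differentials are
restrictions of endomorphisms of `V`. -/
structure InternalBicomplex (R : Type u) [CommRing R] where
  /-- the ambient module -/
  V : Type u
  [addCommGroup : AddCommGroup V]
  [module : Module R V]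
  /-- the component in a bidegree -/
  N : ℤ → ℤ → Submodule R V
  /-- the vertical differential -/
  δ0 : V →ₗ[R] V
  /-- the horizontal differential -/
  δ1 : V →ₗ[R] V
  δ0_mem : ∀ {i j x}, x ∈ N i j → δ0 x ∈ N i (j + 1)
  δ1_mem : ∀ {i j x}, x ∈ N (i + 1) j → δ1 x ∈ N i j
  δ0_δ0 : ∀ x, δ0 (δ0 x) = 0
  δ1_δ1 : ∀ x, δ1 (δ1 x) = 0
  δ0_δ1 : ∀ x, δ0 (δ1 x) = δ1 (δ0 x)

namespace InternalBicomplex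

attribute [instance] addCommGroup module

variable {R : Type u} [CommRing R] (T : InternalBicomplex R)

/-- The restriction of the vertical differential. -/
def res0 (i j j' : ℤ) : T.N i j →ₗ[R] T.N i j' :=
  if h : j + 1 = j' then T.δ0.restrict (fun _ hx => h ▸ T.δ0_mem hx) else 0

/-- The restriction of the horizontal differential. -/
def res1 (i i' j : ℤ) : T.N i j →ₗ[R] T.N i' j :=
  if h : i' + 1 = i then T.δ1.restrict (fun _ hx => T.δ1_mem (h ▸ hx)) else 0

lemma coe_res0 (i j j' : ℤ) (x : T.N i j) :
    (T.res0 i j j' x : T.V) = if j + 1 = j' then T.δ0 x else 0 := by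
  unfold res0
  split_ifs <;> rfl

lemma coe_res1 (i i' j : ℤ) (x : T.N i j) :
    (T.res1 i i' j x : T.V) = if i' + 1 = i then T.δ1 x else 0 := by
  unfold res1
  split_ifs <;> rfl

lemma res1_res1 (i i' i'' j : ℤ) (x : T.N i j) : T.res1 i' i'' j (T.res1 i i' j x) = 0 := by
  apply Subtype.ext
  rw [coe_res1, coe_res1]
  split_ifs
  · exact T.δ1_δ1 _
  · exact map_zero _
  · rfl

lemma res0_res0 (i j j' j'' : ℤ) (x : T.N i j) : T.res0 i j' j'' (T.res0 i j j' x) = 0 := by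
  apply Subtype.ext
  rw [coe_res0, coe_res0]
  split_ifs
  · exact T.δ0_δ0 _
  · exact map_zero _
  · rfl

lemma res0_res1 (i i' j j' : ℤ) (x : T.N i j) :
    T.res0 i' j j' (T.res1 i i' j x) = T.res1 i i' j' (T.res0 i j j' x) := by
  apply Subtype.ext
  rw [coe_res0, coe_res1, coe_res1, coe_res0]
  split_ifs
  · exact T.δ0_δ1 _
  · exact map_zero _
  · exact (map_zero _).symm
  · rfl

/-- The associated bicomplex. -/
def toBicomplex : Bicomplex R :=
  HomologicalComplex₂.ofGradedObject (ComplexShape.down ℤ) (ComplexShape.up ℤ)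
    (fun s => ModuleCat.of R (T.N s.1 s.2))
    (fun i i' j => ModuleCat.ofHom (T.res1 i i' j))
    (fun i j j' => ModuleCat.ofHom (T.res0 i j j'))
    (fun i i' hi j => by
      rw [res1, dif_neg (show ¬i' + 1 = i from hi)]
      rfl)
    (fun i j j' hj => by
      rw [res0, dif_neg (show ¬j + 1 = j' from hj)]
      rfl)
    (fun i i' i'' j => ModuleCat.hom_ext (LinearMap.ext (T.res1_res1 i i' i'' j)))
    (fun i j j' j'' => ModuleCat.hom_ext (LinearMap.ext (T.res0_res0 i j j' j'')))
    (fun i i' j j' => ModuleCat.hom_ext (LinearMap.ext (T.res0_res1 i i' j j')))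

/-- The element of `V` underlying an element of the associated bicomplex. -/
def coe (i j : ℤ) : T.toBicomplex.comp i j →ₗ[R] T.V := (T.N i j).subtype

/-- The element of the associated bicomplex given by an element of `V`. -/
def elt {i j : ℤ} (x : T.V) (hx : x ∈ T.N i j) : T.toBicomplex.comp i j := ⟨x, hx⟩

lemma coe_mem {i j : ℤ} (x : T.toBicomplex.comp i j) : T.coe i j x ∈ T.N i j := x.2

lemma coe_injective (i j : ℤ) : Function.Injective (T.coe i j) := Subtype.val_injective

lemma coe_d0 {i j j' : ℤ} (h : j + 1 = j') (x : T.toBicomplex.comp i j) :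
    T.coe i j' (T.toBicomplex.d0 i j j' x) = T.δ0 (T.coe i j x) :=
  (T.coe_res0 i j j' x).trans (if_pos h)

lemma coe_d1 {i i' j : ℤ} (h : i' + 1 = i) (x : T.toBicomplex.comp i j) :
    T.coe i' j (T.toBicomplex.d1 i i' j x) = T.δ1 (T.coe i j x) :=
  (T.coe_res1 i i' j x).trans (if_pos h)

/-- In the ambient module transports disappear: equality of bidegrees only affects membership. This
is the benefit of building the covers inside a single module. -/
lemma coe_transport {i i' j j' : ℤ} (hi : i = i') (hj : j = j') (x : T.toBicomplex.comp i j) :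
    T.coe i' j' (T.toBicomplex.transport hi hj x) = T.coe i j x := by
  subst hi hj
  rfl

/-- A morphism out of the bicomplex associated with an internal bicomplex. -/
def desc {A : Bicomplex R} (f : ∀ i j, T.V →ₗ[R] A.comp i j)
    (h0 : ∀ i j x, x ∈ T.N i j → A.d0 i j (j + 1) (f i j x) = f i (j + 1) (T.δ0 x))
    (h1 : ∀ i j x, x ∈ T.N (i + 1) j → A.d1 (i + 1) i j (f (i + 1) j x) = f i j (T.δ1 x)) :
    T.toBicomplex ⟶ A :=
  HomologicalComplex₂.homMk
    (fun s => ModuleCat.ofHom (f s.1 s.2 ∘ₗ T.coe s.1 s.2))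
    (fun i i' j hi => by
      obtain rfl : i' + 1 = i := hi
      ext x
      exact (h1 i' j _ (T.coe_mem x)).trans (congrArg (f i' j) (T.coe_d1 rfl x)).symm)
    (fun i j j' hj => by
      obtain rfl : j + 1 = j' := hj
      ext x
      exact (h0 i j _ (T.coe_mem x)).trans (congrArg (f i (j + 1)) (T.coe_d0 rfl x)).symm)

end InternalBicomplex

/-! ### Criteria for the vanishing of a page -/

namespace Bicomplex

variable {R : Type u} [CommRing R]

/-- The `r`-page of `A` vanishes. -/
def PageIsZero (A : Bicomplex R) (r : ℕ) : Prop :=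
  ∀ p q : ℤ, Function.Surjective (A.wMap r p (sub_add_cancel q 1))

/-- E_1 is the cohomology of d₀. -/
lemma wMap_one_surjective {A : Bicomplex R} {p q q' : ℤ} (h : q + 1 = q')
    (H : ∀ x : A.comp p q', A.d0 p q' (q' + 1) x = 0 → ∃ a, A.d0 p q q' a = x) :
    Function.Surjective (A.wMap 1 p h) := by
  intro z
  have hz : A.d0 (p - (0 : ℕ)) (q' - (0 : ℕ)) (q' + 1) (z.1 0) = 0 := z.2.1
  obtain ⟨a, ha⟩ := H (A.transport (by simp) (by simp) (z.1 0)) (by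
    rw [A.d0_transport _ _ rfl]
    exact (congrArg _ hz).trans (map_zero (A.transport _ _)))
  refine ⟨a, ZW_ext (r := 0) fun k => ?_⟩
  fin_cases k
  exact (congrArg _ ha).trans (A.transport_transport _ _ _ _ _)

lemma witness_rel {A : Bicomplex R} {r : ℕ} {p q : ℤ} (z : A.witnessTuples r p q) (k : Fin r)
    {i j i' j' : ℤ} (hi : p - (k.castSucc : ℕ) = i) (hj : q - (k.castSucc : ℕ) = j)
    (hi' : p - (k.succ : ℕ) = i') (hj' : q - (k.succ : ℕ) = j') :
    A.d0 i' j' j (A.transport hi' hj' (z.1 k.succ)) =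
      A.d1 i i' j (A.transport hi hj (z.1 k.castSucc)) := by
  subst hi hj hi' hj'
  exact z.2.2 k

lemma d1_singleTuple (A : Bicomplex R) (r : ℕ) (p q : ℤ) (x : A.comp p q)
    (hx : ∀ i, A.d1 p i q x = 0) (k : Fin (r + 1)) (i : ℤ) :
    A.d1 (p - (k : ℕ)) i (q - (k : ℕ)) (A.singleTuple r p q x k) = 0 := by
  match k with
  | ⟨0, _⟩ =>
    refine (A.d1_transport _ _ rfl x).trans ?_
    rw [hx, map_zero]
  | ⟨k + 1, _⟩ => exact map_zero (A.d1 _ _ _)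

/-- A witness cycle is a witness boundary as soon as its leading term is of the form
`d₁ b_r + d₀ a`. -/
lemma wMap_add_two_surjective {A : Bicomplex R} {r : ℕ} {p q q' : ℤ} (h : q + 1 = q')
    (H : ∀ z : A.witnessTuples (r + 1) p q', ∃ (a : A.comp p q)
      (b : A.witnessTuples r (p + (r + 1 : ℕ)) (q + (r + 1 : ℕ))),
      A.transport (by simp) (by simp; lia) (A.d1 _ p _ (b.1 (Fin.last r))) +
        A.transport (by simp) (by simp) (A.d0 p q q' a) = z.1 0) :
    Function.Surjective (A.wMap (r + 2) p h) := by
  subst h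
  intro (z : A.witnessTuples (r + 1) p (q + 1))
  obtain ⟨a, b, hab⟩ := H z
  have hab' : A.transport (by simp) (by simp) (z.1 0) =
      A.transport rfl (by simp; lia) (A.d1 _ p _ (b.1 (Fin.last r))) + A.d0 p q (q + 1) a :=
    (congrArg (A.transport _ _) hab).symm.trans ((map_add (A.transport _ _) _ _).trans
      (congrArg₂ _ (A.transport_transport _ _ _ _ _) (A.transport_transport _ _ _ _ _)))
  -- Once z₀ = d₁b_r + d₀a, the equation for c forces c = (z₁ − d₁a, z₂, …). It is a cycle because
  -- d₀z₁ = d₁z₀ = d₁d₀a, the term d₁d₁b_r being zero.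
  have hc : (fun k => A.transport (by simp; lia) (by simp) (z.1 k.succ) -
      A.singleTuple r (p - 1) q (A.d1 p (p - 1) q a) k) ∈ A.witnessTuples r (p - 1) q := by
    refine ⟨?_, fun k => ?_⟩
    · rw [map_sub, sub_eq_zero]
      refine (witness_rel z 0 (by simp : p - ((0 : Fin (r + 1)).castSucc : ℕ) = p)
        (by simp) _ (by simp)).trans ?_
      refine Eq.trans ?_ (A.d0_transport _ _ rfl _).symm
      rw [A.d0_d1]
      refine (congrArg _ hab').trans ?_
      rw [map_add, A.d1_transport rfl _ rfl, A.d1_d1, map_zero, zero_add]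
      exact A.d1_eq_transport _ (by simp) _
    · rw [map_sub, map_sub, d1_singleTuple _ _ _ _ _ fun _ => A.d1_d1 _ _ _ _ _, sub_zero]
      refine Eq.trans ?_ (witness_rel z k.succ _ _ (by simp; lia)
        (by simp : q + 1 - (k.succ.succ : ℕ) = q - (k.succ : ℕ)))
      exact (congrArg (_ - ·) (map_zero (A.d0 _ _ _))).trans (sub_zero _)
  refine ⟨((b, a, ⟨_, hc⟩) : A.witnessTuples r (p + (r + 1 : ℕ)) (q + (r + 1 : ℕ)) × A.comp p q ×
      A.witnessTuples r (p - 1) q), ZW_ext (r := r + 1) fun k => ?_⟩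
  match k with
  | ⟨0, _⟩ => exact hab
  | ⟨1, _⟩ =>
    refine (congrArg (_ + ·) ((map_sub (A.transport _ _) _ _).trans
      (congrArg₂ (· - ·) (A.transport_transport _ _ _ _ _)
        (A.transport_transport _ _ _ _ _)))).trans ?_
    exact add_sub_cancel _ _
  | ⟨k + 2, _⟩ =>
    refine (map_sub (A.transport _ _) _ _).trans
      ((congrArg₂ (· - ·) (A.transport_transport _ _ _ _ _) (map_zero (A.transport _ _))).trans ?_)
    exact sub_zero _

end Bicomplex

/-! ### The cover by squares -/

/-- The elements of a bigraded product which are concentrated in bidegree `(p, q)`. -/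
def suppAt (R : Type u) [CommRing R] (M : ℤ → ℤ → ModuleCat.{u} R) (p q : ℤ) :
    Submodule R (∀ i j, M i j) where
  carrier := {m | ∀ i j, ¬(i = p ∧ j = q) → m i j = 0}
  add_mem' hx hy i j h := by
    rw [Pi.add_apply, Pi.add_apply, hx i j h, hy i j h, add_zero]
  zero_mem' _ _ _ := rfl
  smul_mem' c x hx i j h := by
    rw [Pi.smul_apply, Pi.smul_apply, hx i j h, smul_zero]

lemma single_mem_suppAt {R : Type u} [CommRing R] (M : ℤ → ℤ → ModuleCat.{u} R) (p q : ℤ)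
    (x : M p q) : (Pi.single p (Pi.single q x) : ∀ i j, M i j) ∈ suppAt R M p q := by
  intro i j h
  by_cases hi : i = p
  · subst hi
    rw [Pi.single_eq_same, Pi.single_eq_of_ne fun hj => h ⟨rfl, hj⟩]
  · rw [Pi.single_eq_of_ne hi]
    rfl

namespace Bicomplex

variable {R : Type u} [CommRing R] (X : Bicomplex R)

/-- The components of `X`, as a bigraded module. -/
abbrev Elts : Type u := ∀ i j, X.comp i j

/-- The bicomplex of free squares on the elements of `X`. -/
def squareCover : InternalBicomplex R where
  V := X.Elts × X.Elts × X.Elts × X.Elts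
  -- The coordinates are the coefficients of x, d₀x, d₁x and d₀d₁x, each recorded in the bidegree of
  -- x; hence the shifts. The coefficients are elements of X itself, so `squareEval` is linear in
  -- them.
  N i j := (suppAt R X.comp i j).prod ((suppAt R X.comp i (j - 1)).prod
    ((suppAt R X.comp (i + 1) j).prod (suppAt R X.comp (i + 1) (j - 1))))
  δ0 := LinearMap.prod 0 (LinearMap.prod (LinearMap.fst R _ _) (LinearMap.prod 0
    (LinearMap.fst R _ _ ∘ₗ LinearMap.snd R _ _ ∘ₗ LinearMap.snd R _ _)))
  δ1 := LinearMap.prod 0 (LinearMap.prod 0 (LinearMap.prod (LinearMap.fst R _ _)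
    (LinearMap.fst R _ _ ∘ₗ LinearMap.snd R _ _)))
  δ0_mem {i j x} hx := by
    obtain ⟨h1, -, h3, -⟩ := hx
    refine ⟨Submodule.zero_mem _, ?_, Submodule.zero_mem _, ?_⟩
    · rw [add_sub_cancel_right]
      exact h1
    · rw [add_sub_cancel_right]
      exact h3
  δ1_mem {i j x} hx := ⟨Submodule.zero_mem _, Submodule.zero_mem _, hx.1, hx.2.1⟩
  δ0_δ0 _ := rfl
  δ1_δ1 _ := rfl
  δ0_δ1 _ := rfl

/-- The evaluation of squares. -/
def squareEval (i j : ℤ) : X.Elts × X.Elts × X.Elts × X.Elts →ₗ[R] X.comp i j where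
  toFun x := x.1 i j + X.d0 i (j - 1) j (x.2.1 i (j - 1)) + X.d1 (i + 1) i j (x.2.2.1 (i + 1) j) +
    X.d0 i (j - 1) j (X.d1 (i + 1) i (j - 1) (x.2.2.2 (i + 1) (j - 1)))
  map_add' x y := by
    simp only [Prod.fst_add, Prod.snd_add, Pi.add_apply, map_add]
    abel
  map_smul' c x := by
    simp only [Prod.smul_fst, Prod.smul_snd, Pi.smul_apply, map_smul, smul_add, RingHom.id_apply]

lemma squareEval_apply (i : ℤ) {j k : ℤ} (h : k + 1 = j) (x : X.Elts × X.Elts × X.Elts × X.Elts) :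
    X.squareEval i j x = x.1 i j + X.d0 i k j (x.2.1 i k) + X.d1 (i + 1) i j (x.2.2.1 (i + 1) j) +
      X.d0 i k j (X.d1 (i + 1) i k (x.2.2.2 (i + 1) k)) := by
  obtain rfl : k = j - 1 := by lia
  rfl

lemma d0_squareEval (i j : ℤ) (x : X.Elts × X.Elts × X.Elts × X.Elts) :
    X.d0 i j (j + 1) (X.squareEval i j x) = X.squareEval i (j + 1) (0, x.1, 0, x.2.2.1) := by
  rw [X.squareEval_apply i (sub_add_cancel j 1), X.squareEval_apply i rfl]
  simp only [map_add, d0_d0, Pi.zero_apply, map_zero, zero_add, add_zero]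

lemma d1_squareEval (i j : ℤ) (x : X.Elts × X.Elts × X.Elts × X.Elts) :
    X.d1 (i + 1) i j (X.squareEval (i + 1) j x) = X.squareEval i j (0, 0, x.1, x.2.1) := by
  rw [X.squareEval_apply _ (sub_add_cancel j 1), X.squareEval_apply i (sub_add_cancel j 1)]
  simp only [map_add, d1_d1, ← d0_d1, Pi.zero_apply, map_zero, zero_add, add_zero]

lemma squareEval_single (p q : ℤ) (x : X.comp p q) :
    X.squareEval p q (Pi.single p (Pi.single q x), 0, 0, 0) = x := by
  rw [X.squareEval_apply _ (sub_add_cancel q 1)]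
  simp only [Pi.single_eq_same, Pi.zero_apply, map_zero, add_zero]

/-- The morphism from the bicomplex of free squares on the elements of `X`. -/
def squareCoverπ : X.squareCover.toBicomplex ⟶ X :=
  X.squareCover.desc X.squareEval (fun i j x _ => X.d0_squareEval i j x)
    (fun i j x _ => X.d1_squareEval i j x)

lemma squareCoverπ_surjective (p q : ℤ) : Function.Surjective (ZWMap X.squareCoverπ 0 p q) := by
  intro x
  exact ⟨X.squareCover.elt (i := p) (j := q) (Pi.single p (Pi.single q x), 0, 0, 0)
    ⟨single_mem_suppAt _ _ _ _, Submodule.zero_mem _, Submodule.zero_mem _,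
      Submodule.zero_mem _⟩, X.squareEval_single p q x⟩

/-- The kernel of d₀ consists of the vectors (0, n, 0, v), and (0, n, 0, v) = d₀(n, 0, v, 0). -/
lemma exists_d0_squareCover {p q q' : ℤ} (h : q + 1 = q') (x : X.squareCover.toBicomplex.comp p q')
    (hx : X.squareCover.toBicomplex.d0 p q' (q' + 1) x = 0) :
    ∃ a, X.squareCover.toBicomplex.d0 p q q' a = x := by
  subst h
  have hm := X.squareCover.coe_mem x
  have h0 : X.squareCover.δ0 (X.squareCover.coe _ _ x) = 0 := by
    rw [← X.squareCover.coe_d0 rfl, hx, map_zero]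
  generalize hv : X.squareCover.coe _ _ x = v at hm h0
  obtain ⟨m, n, u, v⟩ : X.Elts × X.Elts × X.Elts × X.Elts := v
  obtain rfl : m = 0 := congr(($h0).2.1)
  obtain rfl : u = 0 := congr(($h0).2.2.2)
  have hn : n ∈ suppAt R X.comp p (q + 1 - 1) := hm.2.1
  have hv' : v ∈ suppAt R X.comp (p + 1) (q + 1 - 1) := hm.2.2.2
  rw [add_sub_cancel_right] at hn hv'
  refine ⟨X.squareCover.elt (n, 0, v, 0) ⟨hn, Submodule.zero_mem _, hv', Submodule.zero_mem _⟩, ?_⟩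
  refine X.squareCover.coe_injective _ _ ?_
  exact (X.squareCover.coe_d0 rfl _).trans hv.symm

/-- With d₀ exact, the leading term of any witness cycle is some d₀a, so the criterion applies with
b = 0. -/
lemma pageIsZero_squareCover (r : ℕ) : X.squareCover.toBicomplex.PageIsZero (r + 1) := by
  intro p q
  cases r with
  | zero =>
    exact wMap_one_surjective _ fun x hx => X.exists_d0_squareCover (sub_add_cancel q 1) x hx
  | succ r =>
    refine wMap_add_two_surjective _ fun z => ?_
    have hz : X.squareCover.toBicomplex.d0 p q (q + 1)
        (X.squareCover.toBicomplex.transport (by simp) (by simp) (z.1 0)) = 0 := by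
      rw [d0_transport _ _ _ rfl]
      exact (congrArg _ z.2.1).trans (map_zero (X.squareCover.toBicomplex.transport _ _))
    obtain ⟨a, ha⟩ := X.exists_d0_squareCover (sub_add_cancel q 1) _ hz
    refine ⟨a, 0, ?_⟩
    refine (congrArg₂ _ ((congrArg _ (map_zero (X.squareCover.toBicomplex.d1 _ _ _))).trans
      (map_zero (X.squareCover.toBicomplex.transport _ _))) ((congrArg _ ha).trans
        (X.squareCover.toBicomplex.transport_transport _ _ _ _ _))).trans ?_
    exact zero_add _

end Bicomplex

/-! ### The cover by staircases -/

namespace Bicomplex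

variable {R : Type u} [CommRing R] (X : Bicomplex R) (s : ℕ)

/-- Sequences of families of witness cycles of `X`. -/
abbrev Wits : Type u := ℕ → ∀ p q : ℤ, X.witnessTuples s p q

/-- The sequences of witness cycles `F` such that `F k`
is concentrated in bidegree `(i + k, j + k)`,
and vanishes for `k > s`. -/
def witsSupp (i j : ℤ) : Submodule R (X.Wits s) where
  carrier := {F | ∀ (k : ℕ) (p q : ℤ), ¬(k ≤ s ∧ p = i + k ∧ q = j + k) → F k p q = 0}
  add_mem' hx hy k p q h := by
    rw [Pi.add_apply, Pi.add_apply, Pi.add_apply, hx k p q h, hy k p q h, add_zero]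
  zero_mem' _ _ _ _ := rfl
  smul_mem' c x hx k p q h := by
    rw [Pi.smul_apply, Pi.smul_apply, Pi.smul_apply, hx k p q h, smul_zero]

variable {X s} in
lemma witsSupp_eq_zero {i j : ℤ} {F : X.Wits s} (hF : F ∈ X.witsSupp s i j) {k : ℕ} (hk : s < k) :
    F k = 0 := by
  funext p q
  exact hF k p q fun h => by lia

/-- The shift of sequences. -/
def witsShift : X.Wits s →ₗ[R] X.Wits s := LinearMap.pi fun k => LinearMap.proj (k + 1)

lemma witsShift_apply (F : X.Wits s) (k : ℕ) : X.witsShift s F k = F (k + 1) := rfl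

/-- The bicomplex of free staircases on the witness cycles of `X`. -/
def stairCover : InternalBicomplex R where
  V := X.Wits s × X.Wits s
  -- The two coordinates hold the coefficients of the generators a_k and b_k. Each coefficient is
  -- stored in the bidegree of the whole witness cycle, which is (i + k, j + k) for a_k and (i + 1 +
  -- k, j + k) for b_k when the generator sits in (i, j). As d₀a_{k+1} = b_k, the vertical
  -- differential is a shift; indexing by ℕ with vanishing beyond s lets it act without a case for
  -- the last index.
  N i j := (X.witsSupp s i j).prod (X.witsSupp s (i + 1) j)
  δ0 := LinearMap.prod 0 (X.witsShift s ∘ₗ LinearMap.fst R _ _)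
  δ1 := LinearMap.prod 0 (LinearMap.fst R _ _)
  δ0_mem {i j x} hx := ⟨Submodule.zero_mem _, fun k p q h => hx.1 (k + 1) p q fun h' => h (by
    push_cast at h'
    lia)⟩
  δ1_mem {i j x} hx := ⟨Submodule.zero_mem _, hx.1⟩
  δ0_δ0 _ := rfl
  δ1_δ1 _ := rfl
  δ0_δ1 _ := rfl

variable {s}

/-- The `k`-th components of witness cycles, in bidegree `(i, j)`. -/
def witsEvalAt (k : Fin (s + 1)) (i j : ℤ) :
    (∀ p q : ℤ, X.witnessTuples s p q) →ₗ[R] X.comp i j :=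
  X.transport (add_sub_cancel_right i (k : ℤ)) (add_sub_cancel_right j (k : ℤ)) ∘ₗ
    LinearMap.proj k ∘ₗ (X.witnessTuples s (i + (k : ℕ)) (j + (k : ℕ))).subtype ∘ₗ
      LinearMap.proj (j + (k : ℕ)) ∘ₗ LinearMap.proj (i + (k : ℕ))

lemma witsEvalAt_eq (k : Fin (s + 1)) {i j p q : ℤ} (hp : p - (k : ℕ) = i) (hq : q - (k : ℕ) = j)
    (F : ∀ p q : ℤ, X.witnessTuples s p q) :
    X.witsEvalAt k i j F = X.transport hp hq ((F p q).1 k) := by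
  obtain rfl : p = i + (k : ℕ) := by lia
  obtain rfl : q = j + (k : ℕ) := by lia
  rfl

lemma d0_witsEvalAt_zero (i j : ℤ) (F : ∀ p q : ℤ, X.witnessTuples s p q) :
    X.d0 i j (j + 1) (X.witsEvalAt 0 i j F) = 0 := by
  rw [X.witsEvalAt_eq 0 (by simp : i - ((0 : Fin (s + 1)) : ℕ) = i)
    (by simp : j - ((0 : Fin (s + 1)) : ℕ) = j), d0_transport _ _ _ rfl]
  exact (congrArg _ (F i j).2.1).trans (map_zero (X.transport _ _))

lemma d0_witsEvalAt_succ (k : Fin s) (i j : ℤ) (F : ∀ p q : ℤ, X.witnessTuples s p q) :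
    X.d0 i j (j + 1) (X.witsEvalAt k.succ i j F) =
      X.d1 (i + 1) i (j + 1) (X.witsEvalAt k.castSucc (i + 1) (j + 1) F) := by
  rw [X.witsEvalAt_eq k.succ (add_sub_cancel_right i _) (add_sub_cancel_right j _),
    X.witsEvalAt_eq k.castSucc (p := i + (k.succ : ℕ)) (q := j + (k.succ : ℕ))
      (by simp; lia) (by simp; lia)]
  exact witness_rel _ _ _ _ _ _

/-- The sum of the `k`-th components, in bidegree `(i, j)`, of a sequence of witness cycles. -/
def witsEval (i j : ℤ) : X.Wits s →ₗ[R] X.comp i j :=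
  ∑ k : Fin (s + 1), X.witsEvalAt k i j ∘ₗ LinearMap.proj (k : ℕ)

lemma witsEval_apply (i j : ℤ) (F : X.Wits s) :
    X.witsEval i j F = ∑ k : Fin (s + 1), X.witsEvalAt k i j (F k) := by
  rw [witsEval, LinearMap.sum_apply]
  rfl

/-- The relations d₀a₀ = 0 and d₀a_{k+1} = d₁a_k reindex the sum. The term k = s on the right
vanishes since F is zero at s + 1. -/
lemma d0_witsEval {i j : ℤ} {F : X.Wits s} (hF : F ∈ X.witsSupp s i j) :
    X.d0 i j (j + 1) (X.witsEval i j F) =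
      X.d1 (i + 1) i (j + 1) (X.witsEval (i + 1) (j + 1) (X.witsShift s F)) := by
  rw [witsEval_apply, witsEval_apply, map_sum, map_sum, Fin.sum_univ_succ, d0_witsEvalAt_zero,
    zero_add, Fin.sum_univ_castSucc, witsShift_apply, witsSupp_eq_zero hF (by simp), map_zero,
    map_zero, add_zero]
  exact Finset.sum_congr rfl fun k _ => X.d0_witsEvalAt_succ _ _ _ _

lemma witsEval_single (k : Fin (s + 1)) (p q : ℤ) (z : X.witnessTuples s p q) :
    X.witsEval (p - (k : ℕ)) (q - (k : ℕ)) (Pi.single (k : ℕ) (Pi.single p (Pi.single q z))) =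
      z.1 k := by
  rw [witsEval_apply, Finset.sum_eq_single k, Pi.single_eq_same, X.witsEvalAt_eq k rfl rfl,
    Pi.single_eq_same, Pi.single_eq_same, transport_rfl]
  · intro l _ hl
    rw [Pi.single_eq_of_ne fun h => hl (Fin.ext h), map_zero]
  · exact fun h => (h (Finset.mem_univ k)).elim

/-- The evaluation of staircases. -/
def stairEval (i j : ℤ) : X.Wits s × X.Wits s →ₗ[R] X.comp i j :=
  LinearMap.coprod (X.witsEval i j) (X.d1 (i + 1) i j ∘ₗ X.witsEval (i + 1) j)

lemma stairEval_apply (i j : ℤ) (x : X.Wits s × X.Wits s) :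
    X.stairEval i j x = X.witsEval i j x.1 + X.d1 (i + 1) i j (X.witsEval (i + 1) j x.2) := rfl

lemma d0_stairEval (i j : ℤ) (x : X.Wits s × X.Wits s) (h1 : x.1 ∈ X.witsSupp s i j)
    (h2 : x.2 ∈ X.witsSupp s (i + 1) j) :
    X.d0 i j (j + 1) (X.stairEval i j x) = X.stairEval i (j + 1) (0, X.witsShift s x.1) := by
  rw [stairEval_apply, stairEval_apply, map_add, X.d0_witsEval h1, d0_d1, X.d0_witsEval h2, d1_d1,
    add_zero, map_zero, zero_add]

lemma d1_stairEval (i j : ℤ) (x : X.Wits s × X.Wits s) :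
    X.d1 (i + 1) i j (X.stairEval (i + 1) j x) = X.stairEval i j (0, x.1) := by
  rw [stairEval_apply, stairEval_apply, map_add, d1_d1, add_zero, map_zero, zero_add]

variable (s) in
/-- The morphism from the bicomplex of free staircases on the witness cycles of `X`. -/
def stairCoverπ : (X.stairCover s).toBicomplex ⟶ X :=
  (X.stairCover s).desc X.stairEval (fun i j x hx => X.d0_stairEval i j x hx.1 hx.2)
    (fun i j x _ => X.d1_stairEval i j x)

lemma single_mem_witsSupp (k : Fin (s + 1)) (p q : ℤ) (z : X.witnessTuples s p q) :
    (Pi.single (k : ℕ) (Pi.single p (Pi.single q z)) : X.Wits s) ∈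
      X.witsSupp s (p - (k : ℕ)) (q - (k : ℕ)) := by
  intro l p' q' h
  by_cases hl : l = k
  · subst hl
    rw [Pi.single_eq_same]
    by_cases hp : p' = p
    · subst hp
      rw [Pi.single_eq_same, Pi.single_eq_of_ne]
      rintro rfl
      exact h ⟨Fin.is_le k, by lia, by lia⟩
    · rw [Pi.single_eq_of_ne hp]
      rfl
  · rw [Pi.single_eq_of_ne hl]
    rfl

lemma d0_elt_stairCover {i j j' : ℤ} (hj : j + 1 = j') (α : X.Wits s)
    (hα : ((α, 0) : X.Wits s × X.Wits s) ∈ (X.stairCover s).N i j) (h : ∀ k, α (k + 1) = 0) :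
    (X.stairCover s).toBicomplex.d0 i j j' ((X.stairCover s).elt (α, 0) hα) = 0 := by
  refine (X.stairCover s).coe_injective _ _ (((X.stairCover s).coe_d0 hj _).trans
    (Eq.trans ?_ (map_zero ((X.stairCover s).coe _ _)).symm))
  change ((0, X.witsShift s α) : X.Wits s × X.Wits s) = (0, 0)
  exact congrArg _ (funext h)

lemma d0_elt_eq_d1_elt_stairCover {i i' j j' : ℤ} (hi : i + 1 = i') (hj : j + 1 = j')
    (α α' : X.Wits s) (hα : ((α, 0) : X.Wits s × X.Wits s) ∈ (X.stairCover s).N i j)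
    (hα' : ((α', 0) : X.Wits s × X.Wits s) ∈ (X.stairCover s).N i' j')
    (h : ∀ k, α (k + 1) = α' k) :
    (X.stairCover s).toBicomplex.d0 i j j' ((X.stairCover s).elt (α, 0) hα) =
      (X.stairCover s).toBicomplex.d1 i' i j' ((X.stairCover s).elt (α', 0) hα') := by
  refine (X.stairCover s).coe_injective _ _ (((X.stairCover s).coe_d0 hj _).trans
    (Eq.trans ?_ ((X.stairCover s).coe_d1 hi _).symm))
  change ((0, X.witsShift s α) : X.Wits s × X.Wits s) = (0, α')
  exact congrArg _ (funext h)

/-- The sequence with `z` in position `k`. -/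
def witsSingle (k : ℕ) (p q : ℤ) (z : X.witnessTuples s p q) : X.Wits s :=
  Pi.single k (Pi.single p (Pi.single q z))

lemma witsSingle_of_ne {k l : ℕ} (h : l ≠ k) (p q : ℤ) (z : X.witnessTuples s p q) :
    X.witsSingle k p q z l = 0 :=
  Pi.single_eq_of_ne h _

lemma witsSingle_succ (k l : ℕ) (p q : ℤ) (z : X.witnessTuples s p q) :
    X.witsSingle (k + 1) p q z (l + 1) = X.witsSingle k p q z l := by
  by_cases hl : l = k
  · subst hl
    rw [witsSingle, witsSingle, Pi.single_eq_same, Pi.single_eq_same]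
  · rw [witsSingle_of_ne _ hl, witsSingle_of_ne _ (by simpa using hl)]

/-- The generators (a₀, …, a_s) of the staircase attached to z form a witness cycle of the cover,
and π evaluates it to z. -/
lemma stairCoverπ_surjective (p q : ℤ) :
    Function.Surjective (ZWMap (X.stairCoverπ s) (s + 1) p q) := by
  intro (z : X.witnessTuples s p q)
  let t (k : Fin (s + 1)) : (X.stairCover s).toBicomplex.comp (p - (k : ℕ)) (q - (k : ℕ)) :=
    (X.stairCover s).elt (X.witsSingle k p q z, 0)
      ⟨X.single_mem_witsSupp k p q z, Submodule.zero_mem _⟩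
  have ht : t ∈ (X.stairCover s).toBicomplex.witnessTuples s p q :=
    ⟨X.d0_elt_stairCover (by simp) _ _ fun k => X.witsSingle_of_ne (by simp) p q z,
      fun k => X.d0_elt_eq_d1_elt_stairCover (by simp; lia) (by simp; lia) _ _ _ _
        fun l => X.witsSingle_succ k l p q z⟩
  refine ⟨⟨t, ht⟩, ZW_ext (r := s) fun k => ?_⟩
  change X.stairEval _ _ (X.witsSingle k p q z, 0) = z.1 k
  rw [stairEval_apply, map_zero, map_zero, add_zero]
  exact X.witsEval_single k p q z

end Bicomplex

namespace Bicomplex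

variable {R : Type u} [CommRing R] {X : Bicomplex R} {s : ℕ}

lemma d0_stairCover_eq_zero {i j j' : ℤ} (h : j + 1 = j')
    {x : (X.stairCover s).toBicomplex.comp i j}
    (hx : (X.stairCover s).toBicomplex.d0 i j j' x = 0) {v : X.Wits s × X.Wits s}
    (hv : (X.stairCover s).coe i j x = v) (k : ℕ) : v.1 (k + 1) = 0 := by
  have h0 : (X.stairCover s).δ0 ((X.stairCover s).coe i j x) = 0 := by
    rw [← (X.stairCover s).coe_d0 h, hx, map_zero]
  rw [hv] at h0
  exact congr(($h0).2 k)

lemma d0_stairCover_eq_d1 {i i' j j' : ℤ} (hi : i + 1 = i') (hj : j + 1 = j')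
    {x : (X.stairCover s).toBicomplex.comp i j} {y : (X.stairCover s).toBicomplex.comp i' j'}
    (hxy : (X.stairCover s).toBicomplex.d0 i j j' x = (X.stairCover s).toBicomplex.d1 i' i j' y)
    {v v' : X.Wits s × X.Wits s} (hx : (X.stairCover s).coe i j x = v)
    (hy : (X.stairCover s).coe i' j' y = v') (k : ℕ) : v.1 (k + 1) = v'.1 k := by
  have h0 : (X.stairCover s).δ0 ((X.stairCover s).coe i j x) =
      (X.stairCover s).δ1 ((X.stairCover s).coe i' j' y) := by
    rw [← (X.stairCover s).coe_d0 hj, ← (X.stairCover s).coe_d1 hi, hxy]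
  rw [hx, hy] at h0
  exact congr(($h0).2 k)

/-- The leading term of a witness cycle of length `r + 2` in the bicomplex of staircases of length
`s + 1 ≤ r + 1` has no `a`-components. -/
lemma coe_fst_eq_zero {r : ℕ} (hs : s ≤ r) {p q : ℤ}
    (z : (X.stairCover s).toBicomplex.witnessTuples (r + 1) p q) :
    ∃ β, (X.stairCover s).coe _ _ (z.1 0) = ((0 : X.Wits s), β) := by
  choose v hv using fun k => (⟨_, rfl⟩ : ∃ v : X.Wits s × X.Wits s,
    (X.stairCover s).coe _ _ (z.1 k) = v)
  refine ⟨(v 0).2, (hv 0).trans (Prod.ext ?_ rfl)⟩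
  have hm (k : Fin (r + 2)) : (v k).1 ∈ X.witsSupp s (p - (k : ℕ)) (q - (k : ℕ)) := by
    have := (X.stairCover s).coe_mem (z.1 k)
    rw [hv] at this
    exact this.1
  -- The cycle relations carry the coefficient of a₀ in z₀ along the diagonal to the coefficient of
  -- a_k in z_k. At k = r + 1 > s there is no such generator, so it vanishes; the coefficients of
  -- a_{k+1} in z₀ vanish by d₀z₀ = 0.
  have h (k : ℕ) (hk : k < r + 2) : (v ⟨k, hk⟩).1 k = (v 0).1 0 := by
    induction k with
    | zero => rfl
    | succ k ih =>
      exact (d0_stairCover_eq_d1 (by simp; lia) (by simp; lia) (z.2.2 ⟨k, by lia⟩)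
        (hv _) (hv _) k).trans (ih (by lia))
  funext k
  cases k with
  | zero => exact (h (r + 1) (by lia)).symm.trans (witsSupp_eq_zero (hm _) (by lia))
  | succ k => exact d0_stairCover_eq_zero (by simp) z.2.1 (hv 0) k

/-- The sequence `β`, truncated before `s` and shifted by one. -/
def witsTrunc (β : X.Wits s) : X.Wits s
  | 0 => 0
  | k + 1 => if k < s then β k else 0

lemma witsTrunc_mem {β : X.Wits s} {i j : ℤ} (hβ : β ∈ X.witsSupp s (i + 1) (j + 1)) :
    witsTrunc β ∈ X.witsSupp s i j := by
  intro k p q h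
  cases k with
  | zero => rfl
  | succ k =>
    simp only [witsTrunc]
    split_ifs with hk
    · exact hβ k p q fun h' => h (by push_cast; lia)
    · rfl

/-- The sequence given by `β s` in position `s + j - r`. -/
def witsLast (r : ℕ) (β : X.Wits s) (j : ℕ) : X.Wits s := fun k => if k + r = s + j then β s else 0

lemma witsLast_mem {r : ℕ} {β : X.Wits s} {i j : ℤ}
    (hβ : β ∈ X.witsSupp s i j) (l : ℕ) (hl : l ≤ r) {i' j' : ℤ} (hi : i' = i + r - l)
    (hj : j' = j + r - l) :
    witsLast r β l ∈ X.witsSupp s i' j' := by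
  intro k p q h
  simp only [witsLast]
  split_ifs with hk
  · exact hβ s p q fun h' => h (by lia)
  · rfl

/-- The leading term of a cycle is a combination of generators b_k. Those with k < s are d₀a_{k+1}.
The last is b_s = d₁a_s, where a_s ends the witness cycle (0, …, 0, a₀, …, a_s) of length r + 1,
which has room for the staircase because s ≤ r. -/
lemma pageIsZero_stairCover {r : ℕ} (hs : s ≤ r) :
    (X.stairCover s).toBicomplex.PageIsZero (r + 2) := by
  intro p q
  refine wMap_add_two_surjective _ fun z => ?_
  obtain ⟨β, hz⟩ := coe_fst_eq_zero hs z
  have hβ : β ∈ X.witsSupp s (p - (0 : ℕ) + 1) (q - 1 + 1 - (0 : ℕ)) := by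
    have := ((X.stairCover s).coe_mem (z.1 0)).2
    rw [hz] at this
    rw [sub_add_cancel]
    exact this
  rw [Nat.cast_zero, sub_zero, sub_zero] at hβ
  let b (k : Fin (r + 1)) : (X.stairCover s).toBicomplex.comp (p + (r + 1 : ℕ) - (k : ℕ))
      (q - 1 + (r + 1 : ℕ) - (k : ℕ)) :=
    (X.stairCover s).elt (witsLast r β k, 0) ⟨witsLast_mem hβ k (Fin.is_le k)
      (by push_cast; ring) (by push_cast; ring), Submodule.zero_mem _⟩
  have hb : b ∈ (X.stairCover s).toBicomplex.witnessTuples r (p + (r + 1 : ℕ))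
      (q - 1 + (r + 1 : ℕ)) := by
    refine ⟨X.d0_elt_stairCover (by simp) _ _ fun k => if_neg (by simp; lia),
      fun k => X.d0_elt_eq_d1_elt_stairCover (by simp; lia) (by simp; lia) _ _ _ _ fun l => ?_⟩
    simp only [witsLast, Fin.val_succ, Fin.val_castSucc]
    congr 1
    simp only [eq_iff_iff]
    lia
  refine ⟨(X.stairCover s).elt (i := p) (j := q - 1) (witsTrunc β, 0)
    ⟨witsTrunc_mem hβ, Submodule.zero_mem _⟩, ⟨b, hb⟩, (X.stairCover s).coe_injective _ _ ?_⟩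
  refine (map_add ((X.stairCover s).coe _ _) _ _).trans ((congrArg₂ _
    (((X.stairCover s).coe_transport _ _ _).trans ((X.stairCover s).coe_d1 (by simp; lia) _))
    (((X.stairCover s).coe_transport _ _ _).trans ((X.stairCover s).coe_d0 (by simp) _))).trans
      (Eq.trans ?_ hz.symm))
  change ((0 + 0 : X.Wits s), witsLast r β (Fin.last r : ℕ) + X.witsShift s (witsTrunc β)) = _
  refine Prod.ext (zero_add _) (funext fun k => ?_)
  change witsLast r β (Fin.last r : ℕ) k + witsTrunc β (k + 1) = β k
  simp only [witsLast, witsTrunc, Fin.val_last, Nat.add_right_cancel_iff]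
  -- Coefficients below s come from d₀ of the truncation, the one at s from d₁b_r, and those above s
  -- are zero.
  rcases lt_trichotomy k s with hk | rfl | hk
  · rw [if_neg hk.ne, if_pos hk, zero_add]
  · rw [if_pos rfl, if_neg (lt_irrefl _), add_zero]
  · rw [if_neg hk.ne', if_neg hk.not_gt, add_zero, witsSupp_eq_zero hβ hk]

end Bicomplex

/-! ### Acyclic covers and r-quasi-isomorphisms -/

namespace Bicomplex

variable {R : Type u} [CommRing R]

lemma ZWMap_add {A B : Bicomplex R} (f g : A ⟶ B) (r : ℕ) (p q : ℤ) (x : A.ZW r p q) :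
    ZWMap (f + g) r p q x = ZWMap f r p q x + ZWMap g r p q x := by
  cases r with
  | zero => exact app_add f g p q x
  | succ r => exact ZW_ext (r := r) fun k => app_add f g _ _ _

lemma PageIsZero.biprod {A B : Bicomplex R} {r : ℕ} (hA : A.PageIsZero r) (hB : B.PageIsZero r) :
    (A ⊞ B).PageIsZero r := by
  intro p q z
  obtain ⟨x, hx⟩ := hA p q (ZWMap biprod.fst r p q z)
  obtain ⟨y, hy⟩ := hB p q (ZWMap biprod.snd r p q z)
  refine ⟨BWMap biprod.inl r p _ x + BWMap biprod.inr r p _ y, ?_⟩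
  rw [map_add, ← ZWMap_wMap, ← ZWMap_wMap, hx, hy, ← ZWMap_comp, ← ZWMap_comp, ← ZWMap_add,
    biprod.total, ZWMap_id]

lemma ZWMap_biprod_desc_surjective {A B C : Bicomplex R} (f : A ⟶ C) (g : B ⟶ C) {r : ℕ} {p q : ℤ}
    (h : Function.Surjective (ZWMap f r p q) ∨ Function.Surjective (ZWMap g r p q)) :
    Function.Surjective (ZWMap (biprod.desc f g) r p q) := by
  intro z
  rcases h with h | h
  · obtain ⟨x, rfl⟩ := h z
    exact ⟨ZWMap biprod.inl r p q x, by rw [← ZWMap_comp, biprod.inl_desc]⟩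
  · obtain ⟨x, rfl⟩ := h z
    exact ⟨ZWMap biprod.inr r p q x, by rw [← ZWMap_comp, biprod.inr_desc]⟩

/-- Every bicomplex is the target of a morphism from a bicomplex with zero `(r+1)`-page which is
surjective on `s`-witness cycles for all `s ≤ r`. -/
lemma exists_pageIsZero_surjective (X : Bicomplex R) (r : ℕ) :
    ∃ (Q : Bicomplex R) (π : Q ⟶ X), Q.PageIsZero (r + 1) ∧
      ∀ s ≤ r, ∀ p q : ℤ, Function.Surjective (ZWMap π s p q) := by
  suffices ∀ n ≤ r, ∃ (Q : Bicomplex R) (π : Q ⟶ X), Q.PageIsZero (r + 1) ∧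
      ∀ s ≤ n, ∀ p q : ℤ, Function.Surjective (ZWMap π s p q) from this r le_rfl
  intro n hn
  induction n with
  | zero =>
    refine ⟨_, X.squareCoverπ, X.pageIsZero_squareCover r, fun s hs p q => ?_⟩
    obtain rfl : s = 0 := by lia
    exact X.squareCoverπ_surjective p q
  | succ n ih =>
    obtain ⟨Q, π, hQ, hπ⟩ := ih (by lia)
    obtain ⟨r, rfl⟩ : ∃ m, r = m + 1 := ⟨r - 1, by lia⟩
    -- `stairCover n` covers ZW_{n+1} and its pages vanish from index n + 2 on, so n + 1 ≤ r
    -- suffices for the (r + 1)-page.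
    refine ⟨_, biprod.desc π (X.stairCoverπ n), hQ.biprod (pageIsZero_stairCover (by lia)),
      fun s hs p q => ZWMap_biprod_desc_surjective _ _ ?_⟩
    rcases hs.eq_or_lt with rfl | hs
    · exact Or.inr (X.stairCoverπ_surjective p q)
    · exact Or.inl (hπ s (by lia) p q)

lemma pageMap_id (A : Bicomplex R) (r : ℕ) (p q : ℤ) (x : A.page r p q) :
    pageMap (𝟙 A) r p q x = x := by
  obtain ⟨x, rfl⟩ := Submodule.Quotient.mk_surjective _ x
  exact congrArg Submodule.Quotient.mk (ZWMap_id A r p q x)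

lemma pageMap_comp {A B C : Bicomplex R} (f : A ⟶ B) (g : B ⟶ C) (r : ℕ) (p q : ℤ)
    (x : A.page r p q) : pageMap (f ≫ g) r p q x = pageMap g r p q (pageMap f r p q x) := by
  obtain ⟨x, rfl⟩ := Submodule.Quotient.mk_surjective _ x
  exact congrArg Submodule.Quotient.mk (ZWMap_comp f g r p q x)

lemma pageMap_add {A B : Bicomplex R} (f g : A ⟶ B) (r : ℕ) (p q : ℤ)
    (x : A.page r p q) : pageMap (f + g) r p q x = pageMap f r p q x + pageMap g r p q x := by
  obtain ⟨x, rfl⟩ := Submodule.Quotient.mk_surjective _ x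
  exact congrArg Submodule.Quotient.mk (ZWMap_add f g r p q x)

lemma PageIsZero.eq_zero {A : Bicomplex R} {r : ℕ} (h : A.PageIsZero r) {p q : ℤ}
    (x : A.page r p q) : x = 0 := by
  obtain ⟨x, rfl⟩ := Submodule.Quotient.mk_surjective _ x
  exact (Submodule.Quotient.mk_eq_zero _).2 (h p q x)

lemma PageIsZero.pageMap_comp_eq_zero {A B C : Bicomplex R} {r : ℕ} (h : B.PageIsZero r)
    (f : A ⟶ B) (g : B ⟶ C) {p q : ℤ} (x : A.page r p q) : pageMap (f ≫ g) r p q x = 0 := by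
  rw [pageMap_comp, h.eq_zero (pageMap f r p q x), map_zero]

lemma PageIsZero.of_rQuasiIso {A B : Bicomplex R} {r : ℕ} (h : A.PageIsZero (r + 1)) {f : A ⟶ B}
    (hf : rQuasiIso R r f) : B.PageIsZero (r + 1) := by
  intro p q z
  refine (Submodule.Quotient.mk_eq_zero (B.boundaries (r + 1) p q)).1 ?_
  obtain ⟨y, hy⟩ := (hf p q).2 (Submodule.Quotient.mk z)
  rw [← hy, h.eq_zero y, map_zero]

/-- Maps factoring through an object with zero page vanish on that page, so f and g become mutually
inverse there. -/
lemma rQuasiIso_of_inverse {A B Q Q' : Bicomplex R} {r : ℕ} (hQ : Q.PageIsZero (r + 1))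
    (hQ' : Q'.PageIsZero (r + 1)) (f : A ⟶ B) (g : B ⟶ A) {a : A ⟶ Q} {b : Q ⟶ A} {c : B ⟶ Q'}
    {d : Q' ⟶ B} (h : f ≫ g + a ≫ b = 𝟙 A) (h' : g ≫ f + c ≫ d = 𝟙 B) : rQuasiIso R r f := by
  intro p q
  refine Function.bijective_iff_has_inverse.2 ⟨pageMap g (r + 1) p q, fun x => ?_, fun x => ?_⟩
  · rw [← pageMap_comp, ← add_zero (pageMap (f ≫ g) _ _ _ _), ← hQ.pageMap_comp_eq_zero a b x,
      ← pageMap_add, h, pageMap_id]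
  · rw [← pageMap_comp, ← add_zero (pageMap (g ≫ f) _ _ _ _), ← hQ'.pageMap_comp_eq_zero c d x,
      ← pageMap_add, h', pageMap_id]

lemma pageIsZero_zero (r : ℕ) : (0 : Bicomplex R).PageIsZero r := by
  intro p q z
  have h := ZWMap_add (𝟙 (0 : Bicomplex R)) (𝟙 0) r p q z
  -- For the zero object 1 + 1 = 1, hence z = z + z.
  rw [(isZero_zero (Bicomplex R)).eq_of_src (𝟙 0 + 𝟙 0) (𝟙 0), ZWMap_id] at h
  exact ⟨0, (map_zero _).trans (left_eq_add.1 h).symm⟩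

instance (r : ℕ) : (rQuasiIso R r).HasTwoOutOfThreeProperty where
  comp_mem f g hf hg p q := by
    have : ⇑(pageMap (f ≫ g) (r + 1) p q) = pageMap g _ p q ∘ pageMap f _ p q :=
      funext (pageMap_comp f g _ p q)
    rw [this]
    exact (hg p q).comp (hf p q)
  of_postcomp f g hg hfg p q := by
    have : ⇑(pageMap (f ≫ g) (r + 1) p q) = pageMap g _ p q ∘ pageMap f _ p q :=
      funext (pageMap_comp f g _ p q)
    exact (Function.Bijective.of_comp_iff' (hg p q) _).1 (this ▸ hfg p q)
  of_precomp f g hf hfg p q := by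
    have : ⇑(pageMap (f ≫ g) (r + 1) p q) = pageMap g _ p q ∘ pageMap f _ p q :=
      funext (pageMap_comp f g _ p q)
    exact (Function.Bijective.of_comp_iff _ (hf p q)).1 (this ▸ hfg p q)

end Bicomplex

/-! ### Finite presentability of finite diagrams -/

namespace CategoryTheory.IsFiltered

/-- Finitely many conditions, each attained at some later stage and then preserved, hold together at
one stage. -/
lemma exists_forall_of_finite {J : Type w} [Category.{v} J] [IsFiltered J] {ι : Type*} [Finite ι]
    (k : J) (Q : ι → ∀ k', (k ⟶ k') → Prop)
    (mono : ∀ i k' k'' φ (ψ : k' ⟶ k''), Q i k' φ → Q i k'' (φ ≫ ψ))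
    (h : ∀ i, ∃ k' φ, Q i k' φ) : ∃ k' φ, ∀ i, Q i k' φ := by
  classical
  have := Fintype.ofFinite ι
  suffices ∀ s : Finset ι, ∃ k' φ, ∀ i ∈ s, Q i k' φ by simpa using this Finset.univ
  intro s
  induction s using Finset.induction_on with
  | empty => exact ⟨k, 𝟙 k, by simp⟩
  | insert i s _ ih =>
    obtain ⟨k₁, φ₁, h₁⟩ := ih
    obtain ⟨k₂, φ₂, h₂⟩ := h i
    obtain ⟨m, a, b, hab⟩ := IsFiltered.span φ₁ φ₂
    refine ⟨m, φ₁ ≫ a, fun j hj => ?_⟩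
    obtain rfl | hj := Finset.mem_insert.1 hj
    · rw [hab]
      exact mono _ _ _ _ _ h₂
    · exact mono _ _ _ _ _ (h₁ j hj)

end CategoryTheory.IsFiltered

namespace Bicomplex

variable {R : Type u} [CommRing R]

/-- The functor `A ↦ A^{i,j}`, with values in the category of types. -/
def evalFunctor (R : Type u) [CommRing R] (i j : ℤ) : Bicomplex R ⥤ Type u :=
  HomologicalComplex.eval _ _ i ⋙ HomologicalComplex.eval _ _ j ⋙ forget (ModuleCat.{u} R)

section

variable {J : Type u} [SmallCategory J] [IsFiltered J] {F : J ⥤ Bicomplex R} {c : Cocone F}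
  (hc : IsColimit c)

instance (i j : ℤ) : PreservesColimitsOfShape J (evalFunctor R i j) := by
  unfold evalFunctor
  infer_instance

include hc

lemma exists_app_eq (i j : ℤ) (x : c.pt.comp i j) : ∃ k y, app (c.ι.app k) i j y = x :=
  Types.jointly_surjective_of_isColimit (isColimitOfPreserves (evalFunctor R i j) hc) x

lemma exists_app_map_eq (i j : ℤ) {k : J} {x y : (F.obj k).comp i j}
    (h : app (c.ι.app k) i j x = app (c.ι.app k) i j y) :
    ∃ (k' : J) (φ : k ⟶ k'), app (F.map φ) i j x = app (F.map φ) i j y :=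
  (Types.FilteredColimit.isColimit_eq_iff' (isColimitOfPreserves (evalFunctor R i j) hc) x y).1 h

end

end Bicomplex

namespace BicomplexDiagram

variable {R : Type u} [CommRing R] (D : BicomplexDiagram)

lemma val_app {A B : Bicomplex R} (f : A ⟶ B)
    (t : ∀ s : ℤ × ℤ, {g // D.deg g = s} → A.comp s.1 s.2) (s : ℤ × ℤ) (o : Option D.Gen) :
    D.val (fun s g => Bicomplex.app f s.1 s.2 (t s g)) s o =
      Bicomplex.app f s.1 s.2 (D.val t s o) := by
  cases o with
  | none => exact (map_zero _).symm
  | some g =>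
    by_cases hg : D.deg g = s
    · rw [val_some _ _ hg, val_some _ _ hg]
    · exact (dif_neg hg).trans ((congrArg _ (dif_neg hg)).trans
        (map_zero (Bicomplex.app f s.1 s.2))).symm

lemma val_eq_app_elt {A : Bicomplex R} (f : D.toBicomplex R ⟶ A)
    (t : ∀ s : ℤ × ℤ, {g // D.deg g = s} → A.comp s.1 s.2)
    (ht : ∀ g, t (D.deg g) ⟨g, rfl⟩ = Bicomplex.app f _ _ (D.elt R _ _ (some g))) (s : ℤ × ℤ)
    (o : Option D.Gen) : D.val t s o = Bicomplex.app f s.1 s.2 (D.elt R s.1 s.2 o) := by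
  cases o with
  | none => exact (map_zero (Bicomplex.app f s.1 s.2)).symm
  | some g =>
    by_cases hg : D.deg g = s
    · subst hg
      rw [val_some _ _ rfl, ht]
    · exact (dif_neg hg).trans ((congrArg _ (dif_neg hg)).trans
        (map_zero (Bicomplex.app f s.1 s.2))).symm

section

variable {D} [Finite D.Gen] {J : Type u} [SmallCategory J] [IsFiltered J] {F : J ⥤ Bicomplex R}
  {c : Cocone F} (hc : IsColimit c)

include hc

/-- A morphism out of a finite diagram is a finite family of elements subject to finitely many
equations. The elements lift to one stage of the filtered colimit, and the equations hold at a later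
one. -/
lemma exists_hom_of_isColimit (f : D.toBicomplex R ⟶ c.pt) :
    ∃ (k : J) (g : D.toBicomplex R ⟶ F.obj k), f = g ≫ c.ι.app k := by
  obtain ⟨k₀⟩ := IsFiltered.nonempty (C := J)
  obtain ⟨k, -, hk⟩ := IsFiltered.exists_forall_of_finite k₀
    (fun (g : D.Gen) k _ => ∃ y : (F.obj k).comp (D.deg g).1 (D.deg g).2,
      Bicomplex.app (c.ι.app k) _ _ y = Bicomplex.app f _ _ (D.elt R _ _ (some g)))
    (fun g k k' _ ψ ⟨y, hy⟩ => ⟨Bicomplex.app (F.map ψ) _ _ y, by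
      rw [← Bicomplex.app_comp, c.w, hy]⟩)
    (fun g => by
      obtain ⟨k, y, hy⟩ := Bicomplex.exists_app_eq hc _ _
        (Bicomplex.app f _ _ (D.elt R (D.deg g).1 (D.deg g).2 (some g)))
      exact ⟨_, IsFiltered.leftToMax k₀ k,
        Bicomplex.app (F.map (IsFiltered.rightToMax k₀ k)) _ _ y, by
          rw [← Bicomplex.app_comp, c.w, hy]⟩)
  choose y hy using hk
  let t (s : ℤ × ℤ) (g : {g // D.deg g = s}) : (F.obj k).comp s.1 s.2 :=
    (F.obj k).transport congr(($(g.2)).1) congr(($(g.2)).2) (y g.1)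
  have ht (s : ℤ × ℤ) (o : Option D.Gen) : Bicomplex.app (c.ι.app k) s.1 s.2 (D.val t s o) =
      Bicomplex.app f s.1 s.2 (D.elt R s.1 s.2 o) :=
    (D.val_app _ _ _ _).symm.trans (D.val_eq_app_elt f _ hy s o)
  -- At stage k the chosen elements need not respect the differentials; they do so in the colimit,
  -- hence at some k'.
  obtain ⟨k', φ, hφ⟩ := IsFiltered.exists_forall_of_finite k
    (Sum.elim (fun (g : D.Gen) k' φ => Bicomplex.app (F.map φ) _ _
        ((F.obj k).d0 (D.deg g).1 (D.deg g).2 ((D.deg g).2 + 1) (t _ ⟨g, rfl⟩)) =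
          Bicomplex.app (F.map φ) _ _ (D.val t ((D.deg g).1, (D.deg g).2 + 1) (D.d0 g)))
      (fun (g : D.Gen) k' φ => Bicomplex.app (F.map φ) _ _
        ((F.obj k).d1 (D.deg g).1 ((D.deg g).1 - 1) (D.deg g).2 (t _ ⟨g, rfl⟩)) =
          Bicomplex.app (F.map φ) _ _ (D.val t ((D.deg g).1 - 1, (D.deg g).2) (D.d1 g))))
    (by
      rintro (g | g) k' k'' φ ψ h
      · refine (congrArg (fun z => Bicomplex.app z _ _ _) (F.map_comp φ ψ)).trans (Eq.trans ?_
          (congrArg (fun z => Bicomplex.app z _ _ _) (F.map_comp φ ψ)).symm)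
        exact congrArg (Bicomplex.app (F.map ψ) _ _) h
      · refine (congrArg (fun z => Bicomplex.app z _ _ _) (F.map_comp φ ψ)).trans (Eq.trans ?_
          (congrArg (fun z => Bicomplex.app z _ _ _) (F.map_comp φ ψ)).symm)
        exact congrArg (Bicomplex.app (F.map ψ) _ _) h)
    (by
      rintro (g | g)
      · refine Bicomplex.exists_app_map_eq hc _ _ ?_
        refine Eq.trans ?_ (ht ((D.deg g).1, (D.deg g).2 + 1) _).symm
        refine (Bicomplex.app_d0 _ _ _ _ _).trans ((congrArg _ (hy g)).trans ?_)
        exact (Bicomplex.app_d0 _ _ _ _ _).symm.trans (congrArg _ (D.d0_elt _ _ _ _ rfl))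
      · refine Bicomplex.exists_app_map_eq hc _ _ ?_
        refine Eq.trans ?_ (ht ((D.deg g).1 - 1, (D.deg g).2) _).symm
        refine (Bicomplex.app_d1 _ _ _ _ _).trans ((congrArg _ (hy g)).trans ?_)
        exact (Bicomplex.app_d1 _ _ _ _ _).symm.trans
          (congrArg _ (D.d1_elt _ _ _ _ (sub_add_cancel _ _))))
  refine ⟨k', D.desc (fun s g => Bicomplex.app (F.map φ) s.1 s.2 (t s g)) ?_ ?_,
    hom_ext D fun x => ?_⟩
  · rintro _ ⟨g, rfl⟩
    exact (Bicomplex.app_d0 _ _ _ _ _).symm.trans ((hφ (Sum.inl g)).trans (D.val_app _ _ _ _).symm)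
  · rintro _ ⟨g, rfl⟩
    exact (Bicomplex.app_d1 _ _ _ _ _).symm.trans ((hφ (Sum.inr g)).trans (D.val_app _ _ _ _).symm)
  · rw [Bicomplex.app_comp]
    refine Eq.trans ?_ (congrArg _ (D.app_desc_elt _ _ _ _ _ _).symm)
    refine Eq.trans ?_ (congrArg _ (D.val_app _ _ _ _).symm)
    rw [← Bicomplex.app_comp, c.w]
    exact (ht _ _).symm

lemma exists_comp_map_eq {k : J} {f g : D.toBicomplex R ⟶ F.obj k}
    (h : f ≫ c.ι.app k = g ≫ c.ι.app k) : ∃ (k' : J) (φ : k ⟶ k'), f ≫ F.map φ = g ≫ F.map φ := by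
  obtain ⟨k', φ, hφ⟩ := IsFiltered.exists_forall_of_finite k
    (fun (x : D.Gen) k' φ => Bicomplex.app (f ≫ F.map φ) _ _ (D.elt R _ _ (some x)) =
      Bicomplex.app (g ≫ F.map φ) _ _ (D.elt R (D.deg x).1 (D.deg x).2 (some x)))
    (fun x k' k'' φ ψ h => by
      rw [F.map_comp, ← Category.assoc, ← Category.assoc, Bicomplex.app_comp, h,
        ← Bicomplex.app_comp])
    (fun x => Bicomplex.exists_app_map_eq hc _ _
      (congrArg (fun z => Bicomplex.app z _ _ (D.elt R _ _ (some x))) h))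
  exact ⟨k', φ, hom_ext D hφ⟩

end

instance [Finite D.Gen] : IsFinitelyPresentable.{u} (D.toBicomplex R) := by
  rw [isFinitelyPresentable_iff_preservesFilteredColimitsOfSize]
  refine ⟨fun J _ _ => ⟨fun {F} => ⟨fun {c} hc => ⟨?_⟩⟩⟩⟩
  exact Types.FilteredColimit.isColimitOf' _ _ (exists_hom_of_isColimit hc)
    (fun k f g h => exists_comp_map_eq hc h)

end BicomplexDiagram

namespace Bicomplex

variable (R : Type u) [CommRing R]

instance : Finite SquareGen :=
  Finite.of_surjective (fun k : Fin 4 => match k with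
    | 0 => SquareGen.x
    | 1 => SquareGen.d0x
    | 2 => SquareGen.d1x
    | 3 => SquareGen.d0d1x) (by
      rintro (_ | _ | _ | _)
      exacts [⟨0, rfl⟩, ⟨1, rfl⟩, ⟨2, rfl⟩, ⟨3, rfl⟩])

instance (r : ℕ) : Finite (StairGen r) :=
  Finite.of_surjective (Sum.elim StairGen.a StairGen.b) (by
    rintro (k | k)
    exacts [⟨Sum.inl k, rfl⟩, ⟨Sum.inr k, rfl⟩])

instance isFinitelyPresentable_repZW (r : ℕ) (p q : ℤ) :
    IsFinitelyPresentable.{u} (repZW R r p q) := by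
  cases r with
  | zero =>
    have : Finite (squareDiagram p q).Gen := inferInstanceAs (Finite SquareGen)
    exact inferInstanceAs (IsFinitelyPresentable.{u} ((squareDiagram p q).toBicomplex R))
  | succ r =>
    have : Finite (stairDiagram r p q).Gen := inferInstanceAs (Finite (StairGen r))
    exact inferInstanceAs (IsFinitelyPresentable.{u} ((stairDiagram r p q).toBicomplex R))

attribute [local instance] Cardinal.fact_isRegular_aleph0

instance isFinitelyPresentable_zero : IsFinitelyPresentable.{u} (0 : Bicomplex R) := by
  have (k : Discrete PEmpty.{1}) :
      IsFinitelyPresentable.{u} ((Functor.empty.{0} (Bicomplex R)).obj k) := k.as.elim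
  exact isCardinalPresentable_of_isColimit _ (isZero_zero (Bicomplex R)).isInitial
    Cardinal.aleph0.{u} (hasCardinalLT_of_finite _ _ le_rfl)

instance isFinitelyPresentable_biprod (A B : Bicomplex R) [IsFinitelyPresentable.{u} A]
    [IsFinitelyPresentable.{u} B] : IsFinitelyPresentable.{u} (A ⊞ B) := by
  have (k : Discrete WalkingPair) : IsFinitelyPresentable.{u} ((pair A B).obj k) := by
    obtain ⟨_ | _⟩ := k <;> assumption
  exact isCardinalPresentable_of_isColimit _ (BinaryBiproduct.isColimit A B) Cardinal.aleph0.{u}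
    (hasCardinalLT_of_finite _ _ le_rfl)

instance isFinitelyPresentable_repBW (r : ℕ) (p q : ℤ) :
    IsFinitelyPresentable.{u} (repBW R r p q) := by
  match r with
  | 0 => exact isFinitelyPresentable_zero R
  | 1 => exact isFinitelyPresentable_repZW R 0 p q
  | r + 2 =>
    exact inferInstanceAs (IsFinitelyPresentable.{u}
      (repZW R (r + 1) (p + (r + 1 : ℕ)) (q + (r + 1 : ℕ)) ⊞
        (repZW R 0 p q ⊞ repZW R (r + 1) (p - 1) q)))

end Bicomplex

/-! ### Smallness and the small object argument -/

section Presentable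

variable {C : Type u} [Category.{v} C]

/-- The index set is a nonempty linear order, hence filtered. -/
lemma isSmallRelTo_of_isFinitelyPresentable (κ : Cardinal.{v}) (D : MorphismProperty C) (A : C)
    [IsFinitelyPresentable.{v} A] : IsSmallRelTo κ D A := by
  intro J _ _ _ _ _ _ F _ _
  infer_instance

lemma isSmallObjRelTo_of_isFinitelyPresentable (D : MorphismProperty C) (A : C)
    [IsFinitelyPresentable.{v} A] : IsSmallObjRelTo D A :=
  ⟨0, isSmallRelTo_of_isFinitelyPresentable 0 D A⟩

lemma isFiniteObjRelTo_of_isFinitelyPresentable (D : MorphismProperty C) (A : C)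
    [IsFinitelyPresentable.{v} A] : IsFiniteObjRelTo D A :=
  ⟨0, Cardinal.aleph0_pos, isSmallRelTo_of_isFinitelyPresentable 0 D A⟩

attribute [local instance] Cardinal.fact_isRegular_aleph0
  Cardinal.orderBotAleph0OrdToType

lemma hasSmallObjectArgument_of_isFinitelyPresentable [HasColimits C] (I : MorphismProperty C)
    [MorphismProperty.IsSmall.{v} I]
    (hI : ∀ ⦃X Y : C⦄ (i : X ⟶ Y), I i → IsFinitelyPresentable.{v} X) :
    MorphismProperty.HasSmallObjectArgument.{v} I :=
  ⟨.aleph0, inferInstance, inferInstance,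
    { preservesColimit := fun i hi _ _ => by
        have := hI i hi
        infer_instance }⟩

end Presentable

/-! ### The model structure and right properness -/

namespace Bicomplex

variable (R : Type u) [CommRing R]

lemma hasLimits : HasLimits (Bicomplex R) := inferInstance

lemma hasColimits : HasColimits (Bicomplex R) := inferInstance

/-- Embedding J_S into a family indexed by ℕ × ℤ × ℤ bounds its size and exposes the form of its
members. -/
lemma setJ_le (S : Set ℕ) : setJ R S ≤ MorphismProperty.ofHoms fun t : ℕ × ℤ × ℤ =>
    (0 : (0 : Bicomplex R) ⟶ repZW R t.1 t.2.1 t.2.2) := by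
  refine iSup₂_le fun s _ => sup_le ?_ ?_
  · rintro _ _ _ ⟨pq⟩
    exact ⟨(s, pq)⟩
  · rintro _ _ _ ⟨pq⟩
    exact ⟨(0, pq)⟩

instance isSmall_setJ (S : Set ℕ) : MorphismProperty.IsSmall.{u} (setJ R S) :=
  ⟨small_subset (s := MorphismProperty.toSet (MorphismProperty.ofHoms fun t : ℕ × ℤ × ℤ =>
    (0 : (0 : Bicomplex R) ⟶ repZW R t.1 t.2.1 t.2.2))) fun _ hf => setJ_le R S _ hf⟩

lemma setI_le (r : ℕ) (S : Set ℕ) : setI R r S ≤ ⨆ b : Bool, cond b (setIr R r) (setJ R S) :=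
  sup_le (le_iSup (fun b : Bool => cond b (setIr R r) (setJ R S)) true)
    (le_iSup (fun b : Bool => cond b (setIr R r) (setJ R S)) false)

instance isSmall_setI (r : ℕ) (S : Set ℕ) : MorphismProperty.IsSmall.{u} (setI R r S) := by
  have (b : Bool) : MorphismProperty.IsSmall.{u} (cond b (setIr R r) (setJ R S)) := by
    cases b
    · exact isSmall_setJ R S
    · exact MorphismProperty.isSmall_ofHoms _
  exact ⟨small_subset (s := MorphismProperty.toSet (⨆ b : Bool, cond b (setIr R r) (setJ R S)))
    fun _ hf => setI_le R r S _ hf⟩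

variable {R} in
lemma isFinitelyPresentable_of_setJ {S : Set ℕ} {X Y : Bicomplex R} {i : X ⟶ Y}
    (hi : setJ R S i) : IsFinitelyPresentable.{u} X ∧ IsFinitelyPresentable.{u} Y := by
  obtain ⟨t⟩ := setJ_le R S _ hi
  exact ⟨inferInstance, inferInstance⟩

variable {R} in
lemma isFinitelyPresentable_of_setI {r : ℕ} {S : Set ℕ} {X Y : Bicomplex R} {i : X ⟶ Y}
    (hi : setI R r S i) : IsFinitelyPresentable.{u} X ∧ IsFinitelyPresentable.{u} Y := by
  rcases hi with hi | hi
  · obtain ⟨pq⟩ := hi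
    exact ⟨inferInstance, inferInstance⟩
  · exact isFinitelyPresentable_of_setJ hi

instance (S : Set ℕ) : MorphismProperty.HasSmallObjectArgument.{u} (setJ R S) :=
  hasSmallObjectArgument_of_isFinitelyPresentable _ fun _ _ _ hi =>
    (isFinitelyPresentable_of_setJ hi).1

instance (r : ℕ) (S : Set ℕ) : MorphismProperty.HasSmallObjectArgument.{u} (setI R r S) :=
  hasSmallObjectArgument_of_isFinitelyPresentable _ fun _ _ _ hi =>
    (isFinitelyPresentable_of_setI hi).1

variable {R}

lemma setJ_rlp {S : Set ℕ} (h0 : 0 ∈ S) : (setJ R S).rlp = ZWSurjective R S := by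
  ext X Y f
  constructor
  · intro h s hs p q
    exact (hasLiftingProperty_zero_iff f s p q).1
      (h _ (le_iSup₂_of_le (f := fun s (_ : s ∈ S) => setJr R s) s hs le_sup_left _ ⟨(p, q)⟩))
  · intro h _ _ i hi
    rw [setJ, MorphismProperty.iSup_iff] at hi
    obtain ⟨s, hi⟩ := hi
    rw [MorphismProperty.iSup_iff] at hi
    obtain ⟨hs, hi | hi⟩ := hi
    · obtain ⟨pq⟩ := hi
      exact (hasLiftingProperty_zero_iff f _ _ _).2 (h s hs _ _)
    · obtain ⟨pq⟩ := hi
      exact (hasLiftingProperty_zero_iff f _ _ _).2 (h 0 h0 _ _)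

lemma setI_rlp {r : ℕ} {S : Set ℕ} (h0 : 0 ∈ S) (hr : r ∈ S) :
    (setI R r S).rlp = (setJ R S).rlp ⊓ rQuasiIso R r := by
  ext X Y f
  have hI : (setI R r S).rlp f ↔ (setIr R r).rlp f ∧ (setJ R S).rlp f :=
    ⟨fun h => ⟨fun _ _ i hi => h i (Or.inl hi), fun _ _ i hi => h i (Or.inr hi)⟩,
      fun h _ _ i hi => hi.elim (h.1 i) (h.2 i)⟩
  rw [hI, and_comm]
  refine and_congr_right fun h => ?_
  rw [setJ_rlp h0] at h
  exact setIr_rlp_iff_rQuasiIso f r (h 0 h0) (h r hr)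

/-- The map (f, π) : X ⊕ Q → Y is J_S-injective because π is. A lift of the identity of Y that
extends the inclusion of X has components g and h. -/
lemma exists_section_of_llp {S : Set ℕ} (h0 : 0 ∈ S) {X Y Q : Bicomplex R} {f : X ⟶ Y}
    (hf : (setJ R S).rlp.llp f) {π : Q ⟶ Y} (hπ : ZWSurjective R S π) :
    ∃ (g : Y ⟶ X) (h : Y ⟶ Q), f ≫ g = 𝟙 X ∧ f ≫ h = 0 ∧ g ≫ f + h ≫ π = 𝟙 Y := by
  have := hf (biprod.desc f π) (by
    rw [setJ_rlp h0]
    exact fun s hs p q => ZWMap_biprod_desc_surjective _ _ (Or.inr (hπ s hs p q)))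
  have sq : CommSq biprod.inl f (biprod.desc f π) (𝟙 Y) := ⟨by simp⟩
  refine ⟨sq.lift ≫ biprod.fst, sq.lift ≫ biprod.snd, ?_, ?_, ?_⟩
  · rw [sq.fac_left_assoc, biprod.inl_fst]
  · rw [sq.fac_left_assoc, biprod.inl_snd]
  · refine Eq.trans ?_ sq.fac_right
    rw [Category.assoc, Category.assoc, ← Preadditive.comp_add, ← biprod.desc_eq]

lemma rlp_llp_setJ_le {r : ℕ} {S : Set ℕ} (hS : S ⊆ {s | s ≤ r}) (h0 : 0 ∈ S) :
    (setJ R S).rlp.llp ≤ rQuasiIso R r := by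
  intro X Y f hf
  obtain ⟨Q, π, hQ, hπ⟩ := exists_pageIsZero_surjective Y r
  obtain ⟨g, h, hfg, -, hgh⟩ := exists_section_of_llp h0 hf fun s hs => hπ s (hS hs)
  exact rQuasiIso_of_inverse (pageIsZero_zero _) hQ f g (a := (0 : X ⟶ 0)) (b := 0)
    (by rw [hfg, comp_zero, add_zero]) hgh

/-- Retract argument: factor f as a J_S-cofibration followed by a J_S-injective. By two-out-of-three
the second factor is a weak equivalence, hence I_S-injective, so f lifts against it and is a retract
of the first factor. -/
lemma rlp_llp_setI_inf_rQuasiIso {r : ℕ} {S : Set ℕ} (hS : S ⊆ {s | s ≤ r}) (h0 : 0 ∈ S)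
    (hr : r ∈ S) : (setI R r S).rlp.llp ⊓ rQuasiIso R r = (setJ R S).rlp.llp := by
  refine le_antisymm ?_ (le_inf ?_ (rlp_llp_setJ_le hS h0))
  · rintro X Y f ⟨hf, hw⟩
    let d := MorphismProperty.factorizationData (setJ R S).rlp.llp (setJ R S).rlp f
    have hp : rQuasiIso R r d.p :=
      (rQuasiIso R r).of_precomp d.i d.p (rlp_llp_setJ_le hS h0 _ d.hi) (by rwa [d.fac])
    have : HasLiftingProperty f d.p := hf _ (by
      rw [setI_rlp h0 hr]
      exact ⟨d.hp, hp⟩)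
    exact MorphismProperty.of_retract (RetractArrow.ofLeftLiftingProperty d.fac) d.hi
  · rw [setI_rlp h0 hr]
    exact MorphismProperty.antitone_llp inf_le_left

/-- The pullback of a morphism in `J_S`-cof along a morphism in `J_S`-inj is an
`r`-quasi-isomorphism. -/
lemma rQuasiIso_of_isPullback_of_llp {r : ℕ} {S : Set ℕ} (hS : S ⊆ {s | s ≤ r}) (h0 : 0 ∈ S)
    {P X Y B : Bicomplex R} {fst : P ⟶ X} {snd : P ⟶ Y} {p : X ⟶ B} {j : Y ⟶ B}
    (sq : IsPullback fst snd p j) (hp : (setJ R S).rlp p) (hj : (setJ R S).rlp.llp j) :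
    rQuasiIso R r fst := by
  -- Factoring 0 → B yields a cover Q of B that is both acyclic and J_S-cofibrant. The second
  -- property lets Q → B lift through the fibration p to a map l : Q → X.
  let d := MorphismProperty.factorizationData (setJ R S).rlp.llp (setJ R S).rlp
    (0 : (0 : Bicomplex R) ⟶ B)
  have hQ : d.Z.PageIsZero (r + 1) :=
    (pageIsZero_zero _).of_rQuasiIso (rlp_llp_setJ_le hS h0 _ d.hi)
  have hdp : ZWSurjective R S d.p := setJ_rlp (R := R) h0 ▸ d.hp
  obtain ⟨g, h, hjg, hjh, hgh⟩ := exists_section_of_llp h0 hj hdp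
  have := d.hi p hp
  have sq' : CommSq (0 : 0 ⟶ X) d.i p d.p := ⟨by rw [zero_comp, d.fac]⟩
  have hl : sq'.lift ≫ p = d.p := sq'.fac_right
  generalize sq'.lift = l at hl
  -- To map X to P, an element of X must be moved so that its image in B comes from Y. Subtracting l
  -- ∘ h ∘ p does this, since 1 = j ∘ g + π ∘ h on B. Then k is inverse to `fst` up to a map through
  -- Q.
  let k : X ⟶ P := sq.lift (𝟙 X - p ≫ h ≫ l) (p ≫ g) (by
    rw [Preadditive.sub_comp, Category.id_comp, Category.assoc, Category.assoc, Category.assoc, hl,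
      sub_eq_iff_eq_add, ← Preadditive.comp_add, hgh, Category.comp_id])
  refine rQuasiIso_of_inverse (pageIsZero_zero _) hQ fst k (a := (0 : P ⟶ 0)) (b := 0)
    (c := p ≫ h) (d := l) ?_ ?_
  · rw [comp_zero, add_zero]
    refine sq.hom_ext ?_ ?_
    · rw [Category.assoc, sq.lift_fst, Preadditive.comp_sub, Category.comp_id, sq.w_assoc,
        reassoc_of% hjh, zero_comp, comp_zero, sub_zero, Category.id_comp]
    · rw [Category.assoc, sq.lift_snd, sq.w_assoc, hjg, Category.comp_id, Category.id_comp]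
  · rw [sq.lift_fst, Category.assoc, sub_add_cancel]

lemma rQuasiIso_of_isPullback {r : ℕ} {S : Set ℕ} (hS : S ⊆ {s | s ≤ r}) (h0 : 0 ∈ S) (hr : r ∈ S)
    {P X Y B : Bicomplex R} {fst : P ⟶ X} {snd : P ⟶ Y} {p : X ⟶ B} {w : Y ⟶ B}
    (sq : IsPullback fst snd p w) (hp : (setJ R S).rlp p) (hw : rQuasiIso R r w) :
    rQuasiIso R r fst := by
  let d := MorphismProperty.factorizationData (setJ R S).rlp.llp (setJ R S).rlp w
  have hdp : (setI R r S).rlp d.p := by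
    rw [setI_rlp h0 hr]
    exact ⟨d.hp, (rQuasiIso R r).of_precomp d.i d.p (rlp_llp_setJ_le hS h0 _ d.hi)
      (by rwa [d.fac])⟩
  have sq₂ := IsPullback.of_hasPullback p d.p
  -- By pasting, the pullback along w is the pullback along the acyclic fibration `d.p` followed by
  -- the one along the J_S-cofibration `d.i`.
  have sq₁ : IsPullback (sq₂.lift fst (snd ≫ d.i) (by rw [Category.assoc, d.fac, sq.w])) snd
      (pullback.snd p d.p) d.i := by
    refine IsPullback.of_right (h₁₂ := pullback.fst p d.p) (h₂₂ := d.p) (v₁₃ := p) ?_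
      (sq₂.lift_snd _ _ _) sq₂
    rw [sq₂.lift_fst, d.fac]
    exact sq
  have h₁ := rQuasiIso_of_isPullback_of_llp hS h0 sq₁
    (MorphismProperty.of_isPullback sq₂ hp) d.hi
  have h₂ : (setI R r S).rlp (pullback.fst p d.p) := MorphismProperty.of_isPullback sq₂.flip hdp
  rw [setI_rlp h0 hr] at h₂
  rw [← sq₂.lift_fst fst (snd ≫ d.i) (by rw [Category.assoc, d.fac, sq.w])]
  exact (rQuasiIso R r).comp_mem _ _ h₁ h₂.2

variable (R) in
/-- The model structure `(b𝒞)_S`. -/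
abbrev modelCategory {r : ℕ} {S : Set ℕ} (hS : S ⊆ {s | s ≤ r}) (h0 : 0 ∈ S) (hr : r ∈ S) :
    ModelCategory (Bicomplex R) :=
  letI : CategoryWithFibrations (Bicomplex R) := ⟨(setJ R S).rlp⟩
  letI : CategoryWithCofibrations (Bicomplex R) := ⟨(setI R r S).rlp.llp⟩
  letI : CategoryWithWeakEquivalences (Bicomplex R) := ⟨rQuasiIso R r⟩
  haveI : (weakEquivalences (Bicomplex R)).HasTwoOutOfThreeProperty :=
    inferInstanceAs (rQuasiIso R r).HasTwoOutOfThreeProperty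
  haveI : MorphismProperty.IsWeakFactorizationSystem (cofibrations (Bicomplex R))
      (trivialFibrations (Bicomplex R)) := by
    have : trivialFibrations (Bicomplex R) = (setI R r S).rlp := (setI_rlp h0 hr).symm
    rw [this]
    exact ⟨MorphismProperty.rlp_llp_rlp _, rfl,
      inferInstanceAs (MorphismProperty.HasFactorization (setI R r S).rlp.llp (setI R r S).rlp)⟩
  haveI : MorphismProperty.IsWeakFactorizationSystem (trivialCofibrations (Bicomplex R))
      (fibrations (Bicomplex R)) := by
    have : trivialCofibrations (Bicomplex R) = (setJ R S).rlp.llp :=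
      rlp_llp_setI_inf_rQuasiIso hS h0 hr
    rw [this]
    exact ⟨MorphismProperty.rlp_llp_rlp _, rfl,
      inferInstanceAs (MorphismProperty.HasFactorization (setJ R S).rlp.llp (setJ R S).rlp)⟩
  ModelCategory.mk' _

end Bicomplex

end

theorem mainTheorem1 (R : Type u) [CommRing R] (r : ℕ) (S : Set ℕ)
    (hS : S ⊆ {s | s ≤ r}) (h0 : 0 ∈ S) (hr : r ∈ S) :
    ∃ M : ModelCategory (Bicomplex R),
      IsFunctorialModelCategory (Bicomplex R) ∧
      weakEquivalences (Bicomplex R) = Bicomplex.rQuasiIso R r ∧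
      fibrations (Bicomplex R) = Bicomplex.ZWSurjective R S ∧
      IsFinitelyCofibrantlyGeneratedBy (Bicomplex R) (Bicomplex.setI R r S) (Bicomplex.setJ R S) ∧
      IsRightProper (Bicomplex R) := by
  let M := Bicomplex.modelCategory R hS h0 hr
  have hfib : fibrations (Bicomplex R) = (Bicomplex.setJ R S).rlp := rfl
  have hcof : cofibrations (Bicomplex R) = (Bicomplex.setI R r S).rlp.llp := rfl
  have htf : trivialFibrations (Bicomplex R) = (Bicomplex.setI R r S).rlp :=
    (Bicomplex.setI_rlp h0 hr).symm
  have htc : trivialCofibrations (Bicomplex R) = (Bicomplex.setJ R S).rlp.llp :=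
    Bicomplex.rlp_llp_setI_inf_rQuasiIso hS h0 hr
  refine ⟨M, ⟨Bicomplex.hasLimits R, Bicomplex.hasColimits R, ?_, ?_⟩, rfl,
    hfib.trans (Bicomplex.setJ_rlp h0), ⟨⟨Bicomplex.isSmall_setI R r S, Bicomplex.isSmall_setJ R S,
      fun X Y i hi => ?_, fun X Y j hj => ?_, hfib, htf⟩, fun X Y i hi => ?_,
          fun X Y j hj => ?_⟩, ?_⟩
  -- Both factorizations come from the small object argument, which is functorial.
  · rw [htc, hfib]
    infer_instance
  · rw [hcof, htf]
    infer_instance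
  · have := (Bicomplex.isFinitelyPresentable_of_setI hi).1
    exact isSmallObjRelTo_of_isFinitelyPresentable _ _
  · have := (Bicomplex.isFinitelyPresentable_of_setJ hj).1
    exact isSmallObjRelTo_of_isFinitelyPresentable _ _
  · obtain ⟨_, _⟩ := Bicomplex.isFinitelyPresentable_of_setI hi
    exact ⟨isFiniteObjRelTo_of_isFinitelyPresentable _ _,
      isFiniteObjRelTo_of_isFinitelyPresentable _ _⟩
  · obtain ⟨_, _⟩ := Bicomplex.isFinitelyPresentable_of_setJ hj
    exact ⟨isFiniteObjRelTo_of_isFinitelyPresentable _ _,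
      isFiniteObjRelTo_of_isFinitelyPresentable _ _⟩
  · intro P X Y B fst snd p w sq hp hw
    exact Bicomplex.rQuasiIso_of_isPullback hS h0 hr sq hp hw
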